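/- **Setting.** A Lorentzian Kaehler surface $(\tilde M,\tilde g,J)$ is a smooth manifold of real dimension $4$ with a smooth indefinite metric $\tilde g$ and an almost complex structure $J$ such that $\tilde g(JX,JY)=\tilde g(X,Y)$, $\tilde\nabla J=0$ for the Levi-Civita connection $\tilde\nabla$ of $\tilde g$, and the largest complex negative definite subspaces of each tangent space have complex dimension one. A Lorentz surface $(M,g)$ is a smooth $2$-manifold with a smooth metric of index one, with Levi-Civita connection $\nabla$. For a smooth isometric immersion $\phi:M\to\tilde M$ the second fundamental form $h$, the shape operator $A$ and the normal connection $D$ are defined by $\tilde\nabla_XY=\nabla_XY+h(X,Y)$ and $\tilde\nabla_X\xi=-A_\xi X+D_X\xi$ for $X,Y$ tangent and $\xi$ normal to $M$, and $(\bar\nabla_Xh)(Y,Z)=D_Xh(Y,Z)-h(\nabla_XY,Z)-h(Y,\nabla_XZ)$. With $R,R^D,\tilde R$ the curvature tensors of $\nabla,D,\tilde\nabla$, $R(X,Y;Z,W)=g(R(X,Y)Z,W)$ and $\tilde R(X,Y;Z,W)=\tilde g(\tilde R(X,Y)Z,W)$, the equations of Gauss, Codazzi and Ricci are, for $X,Y,Z,W$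 tangent and $\xi,\eta$ normal to $M$, $$R(X,Y;Z,W)=\tilde R(X,Y;Z,W)+\tilde g(h(X,W),h(Y,Z))-\tilde g(h(X,Z),h(Y,W)),$$ $$(\tilde R(X,Y)Z)^\perp=(\bar\nabla_Xh)(Y,Z)-(\bar\nabla_Yh)(X,Z),$$ $$\tilde g(R^D(X,Y)\xi,\eta)=\tilde R(X,Y;\xi,\eta)+g([A_\xi,A_\eta]X,Y).$$ **Theorem.** The equation of Ricci is a consequence of the equations of Gauss and Codazzi for any Lorentz surface in any Lorentzian Kaehler surface. Precisely: (a) Let $\phi:M\to\tilde M$ be a smooth isometric immersion of a Lorentz surface into a Lorentzian Kaehler surface, and let $p\in M$. If the equations of Gauss and Codazzi hold at $p$, then the equation of Ricci holds at $p$. (b) The implication does not depend on $\tilde R$ being the curvature of the connection in the formulas of Gauss and Weingarten. Let $U\subset\mathbb R^2$ be open with a smooth Lorentz metric $g$, and let $\mathcal E=U\times\mathbb R^4$ carry a smooth fibre metric $G$, a smooth complex structure $J$ on the fibres for which $G$ is Hermitian of complex index one, a smooth connection $\tilde\nabla$ with $\tilde\nabla G=0$ and $\tilde\nabla J=0$,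 and a smooth bundle map $\iota:TU\to\mathcal E$, isometric on each fibre, with $\tilde\nabla_X(\iota Y)-\tilde\nabla_Y(\iota X)=\iota[X,Y]$. Define $\nabla$ (the Levi-Civita connection of $g$), $h,A,D,\bar\nabla h,R,R^D$ by the formulas above, identifying $TU$ with $\iota(TU)$. Let $x\in U$, and let $\tilde R$ be any trilinear map $(X,Y,Z)\mapsto\tilde R(X,Y)Z$ on the fibre $\mathcal E_x$ such that $\tilde R(X,Y;Z,W)=G(\tilde R(X,Y)Z,W)$ satisfies $$\tilde R(X,Y;Z,W)=-\tilde R(Y,X;Z,W),\quad \tilde R(X,Y;Z,W)=\tilde R(Z,W;X,Y),\quad \tilde R(X,Y;JZ,W)=-\tilde R(X,Y;Z,JW).$$ If the equations of Gauss and Codazzi hold at $x$ with this $\tilde R$, then so does the equation of Ricci. -/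

import Mathlib

set_option maxSynthPendingDepth 3

open scoped Manifold ContDiff

noncomputable section

namespace LorentzKaehler

/-! ### Indefinite scalar products -/

section LinearAlgebra

variable {V : Type*} [AddCommGroup V] [Module ℝ V] [TopologicalSpace V]
  [IsTopologicalAddGroup V] [ContinuousSMul ℝ V]

/-- `B` is negative definite on the subspace `N`. -/
def NegDefOn (B : V →L[ℝ] V →L[ℝ] ℝ) (N : Submodule ℝ V) : Prop :=
  ∀ v ∈ N, v ≠ 0 → B v v < 0

/-- An indefinite scalar product: symmetric and nondegenerate. -/
structure IsScalarProduct (B : V →L[ℝ] V →L[ℝ] ℝ) : Prop where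
  symm : ∀ u v, B u v = B v u
  nondegenerate : ∀ u, (∀ v, B u v = 0) → u = 0

/-- Lorentzian: the largest negative definite subspaces have dimension one. -/
def IsLorentzian (B : V →L[ℝ] V →L[ℝ] ℝ) : Prop :=
  IsGreatest {k : ℕ | ∃ N : Submodule ℝ V, NegDefOn B N ∧ Module.finrank ℝ N = k} 1

/-- The complex index is one: the largest complex (i.e. `J`-stable) negative definite subspaces
have complex dimension one. -/
def HasComplexIndexOne (B : V →L[ℝ] V →L[ℝ] ℝ) (J : V →L[ℝ] V) : Prop :=
  IsGreatest {k : ℕ | ∃ N : Submodule ℝ V,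
    (∀ v ∈ N, J v ∈ N) ∧ NegDefOn B N ∧ Module.finrank ℝ N = 2 * k} 1

/-- `J` is a complex structure for which the scalar product `B` is Hermitian, of complex
index one. -/
structure IsLorentzHermitian (B : V →L[ℝ] V →L[ℝ] ℝ) (J : V →L[ℝ] V) : Prop where
  sq : ∀ v, J (J v) = -v
  hermitian : ∀ u v, B (J u) (J v) = B u v
  index : HasComplexIndexOne B J

/-- The algebraic curvature identities of an indefinite Kaehler manifold, for a trilinear map
`R(X, Y)Z`, with `R(X, Y; Z, W) = B (R(X, Y)Z) W`. -/
structure IsKaehlerCurvature (B : V →L[ℝ] V →L[ℝ] ℝ) (J : V →L[ℝ] V)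
    (R : V →L[ℝ] V →L[ℝ] V →L[ℝ] V) : Prop where
  skew : ∀ X Y Z W, B (R X Y Z) W = -B (R Y X Z) W
  pair : ∀ X Y Z W, B (R X Y Z) W = B (R Z W X) Y
  complex : ∀ X Y Z W, B (R X Y (J Z)) W = -B (R X Y Z) (J W)

end LinearAlgebra

/-! ### The Levi-Civita connection of a metric on an open set of a vector space -/

section LeviCivita

variable {E : Type*} [NormedAddCommGroup E] [NormedSpace ℝ E]

/-- The Koszul covector `w ↦ (1/2) (∂_u g(v, w) + ∂_v g(u, w) - ∂_w g(u, v))`, that is, the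
Christoffel symbols of the first kind. -/
def koszul (g : E → E →L[ℝ] E →L[ℝ] ℝ) (x : E) : E →L[ℝ] E →L[ℝ] E →L[ℝ] ℝ :=
  (1 / 2 : ℝ) • (fderiv ℝ g x + (fderiv ℝ g x).flip
    - (ContinuousLinearMap.flipₗᵢ ℝ E E ℝ).toContinuousLinearEquiv.toContinuousLinearMap.comp
        (fderiv ℝ g x).flip)

theorem koszul_apply (g : E → E →L[ℝ] E →L[ℝ] ℝ) (x u v w : E) :
    koszul g x u v w =
      (1 / 2) * (fderiv ℝ g x u v w + fderiv ℝ g x v u w - fderiv ℝ g x w u v) := by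
  simp [koszul]

/-- The Christoffel symbols (of the second kind) `Γ_x(u, v)`, obtained by raising an index. -/
def christoffel (g : E → E →L[ℝ] E →L[ℝ] ℝ) (x : E) : E →L[ℝ] E →L[ℝ] E :=
  (ContinuousLinearMap.compL ℝ E (E →L[ℝ] ℝ) E (g x).inverse).comp (koszul g x)

theorem christoffel_apply (g : E → E →L[ℝ] E →L[ℝ] ℝ) (x u v : E) :
    christoffel g x u v = (g x).inverse (koszul g x u v) := rfl

/-- The Riemann curvature tensor `R_x(a, b)c` of the Levi-Civita connection of `g`. -/
def riemann (g : E → E →L[ℝ] E →L[ℝ] ℝ) (x : E) : E →L[ℝ] E →L[ℝ] E →L[ℝ] E :=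
  fderiv ℝ (christoffel g) x - (fderiv ℝ (christoffel g) x).flip
    + (ContinuousLinearMap.compL ℝ E E E).bilinearComp (christoffel g x) (christoffel g x)
    - ((ContinuousLinearMap.compL ℝ E E E).bilinearComp (christoffel g x) (christoffel g x)).flip

theorem riemann_apply (g : E → E →L[ℝ] E →L[ℝ] ℝ) (x a b c : E) :
    riemann g x a b c =
      fderiv ℝ (christoffel g) x a b c - fderiv ℝ (christoffel g) x b a c
        + christoffel g x a (christoffel g x b c) - christoffel g x b (christoffel g x a c) := by
  simp [riemann]

end LeviCivita

/-! ### The extrinsic geometry of a surface in a coordinate domain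

The bundle `T̃` along the surface (for an immersion `φ`, the pull-back of the tangent bundle of
the ambient space) is trivialised over an open set `dom` of the coordinate space `E`, with
fibre `W`. -/

/-- A metric `g` on `dom`, together with a bundle over `dom` with fibre `W`, which carries a
fibre metric `G`, endomorphisms `J`, a connection `d + θ`, and a bundle map `ι` from the tangent
bundle of `dom`. The laws are collected in `SurfaceData.IsLorentzKaehler`. -/
structure SurfaceData (E W : Type*) [NormedAddCommGroup E] [NormedSpace ℝ E]
    [NormedAddCommGroup W] [NormedSpace ℝ W] where
  dom : Set E
  g : E → E →L[ℝ] E →L[ℝ] ℝ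
  ι : E → E →L[ℝ] W
  G : E → W →L[ℝ] W →L[ℝ] ℝ
  J : E → W →L[ℝ] W
  θ : E → E →L[ℝ] W →L[ℝ] W

namespace SurfaceData

variable {E W : Type*} [NormedAddCommGroup E] [NormedSpace ℝ E]
  [NormedAddCommGroup W] [NormedSpace ℝ W] (S : SurfaceData E W)

/-- A Lorentz surface with a Lorentz Hermitian bundle along it, such that `ι` is isometric and the
connection `∇̃` of the bundle satisfies `∇̃ G = 0`, `∇̃ J = 0` and
`∇̃_X (ι Y) - ∇̃_Y (ι X) = ι [X, Y]`. -/
structure IsLorentzKaehler : Prop where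
  isOpen : IsOpen S.dom
  smooth_g : ContDiffOn ℝ ∞ S.g S.dom
  smooth_ι : ContDiffOn ℝ ∞ S.ι S.dom
  smooth_G : ContDiffOn ℝ ∞ S.G S.dom
  smooth_J : ContDiffOn ℝ ∞ S.J S.dom
  smooth_θ : ContDiffOn ℝ ∞ S.θ S.dom
  scalar_g : ∀ x ∈ S.dom, IsScalarProduct (S.g x)
  lorentz_g : ∀ x ∈ S.dom, IsLorentzian (S.g x)
  scalar_G : ∀ x ∈ S.dom, IsScalarProduct (S.G x)
  hermitian : ∀ x ∈ S.dom, IsLorentzHermitian (S.G x) (S.J x)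
  isometric : ∀ x ∈ S.dom, ∀ u v, S.G x (S.ι x u) (S.ι x v) = S.g x u v
  parallel_G : ∀ x ∈ S.dom, ∀ u a b,
    fderiv ℝ S.G x u a b = S.G x (S.θ x u a) b + S.G x a (S.θ x u b)
  parallel_J : ∀ x ∈ S.dom, ∀ u a,
    fderiv ℝ S.J x u a + S.θ x u (S.J x a) = S.J x (S.θ x u a)
  torsion_free : ∀ x ∈ S.dom, ∀ u v,
    fderiv ℝ S.ι x u v + S.θ x u (S.ι x v) = fderiv ℝ S.ι x v u + S.θ x v (S.ι x u)

/-- A vector field tangent to the surface, seen as a section of the bundle. -/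
def push (Y : E → E) : E → W := fun x => S.ι x (Y x)

/-- The connection `∇̃_X V` on sections of the bundle. -/
def covAmbient (X : E → E) (V : E → W) : E → W :=
  fun x => fderiv ℝ V x (X x) + S.θ x (X x) (V x)

/-- The Levi-Civita connection `∇_X Y` of `g`. -/
def nabla (X Y : E → E) : E → E :=
  fun x => fderiv ℝ Y x (X x) + christoffel S.g x (X x) (Y x)

/-- The tangential component of a section `V`: the vector field `T` with
`g(T, u) = G(V, ι u)` for all `u`. -/
def tangential (V : E → W) : E → E :=
  fun x => (S.g x).inverse ((S.G x (V x)).comp (S.ι x))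

/-- The normal component of a section. -/
def normal (V : E → W) : E → W := V - S.push (S.tangential V)

/-- The second fundamental form, from the formula of Gauss `∇̃_X Y = ∇_X Y + h(X, Y)`. -/
def h (X Y : E → E) : E → W := S.covAmbient X (S.push Y) - S.push (S.nabla X Y)

/-- The shape operator `A_ξ X`, from the formula of Weingarten `∇̃_X ξ = -A_ξ X + D_X ξ`. -/
def shape (ξ : E → W) (X : E → E) : E → E := -S.tangential (S.covAmbient X ξ)

/-- The normal connection `D_X ξ`, from the formula of Weingarten. -/
def normalCov (X : E → E) (ξ : E → W) : E → W := S.normal (S.covAmbient X ξ)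

/-- `(∇̄_X h)(Y, Z) = D_X h(Y, Z) - h(∇_X Y, Z) - h(Y, ∇_X Z)`. -/
def nablaBarH (X Y Z : E → E) : E → W :=
  S.normalCov X (S.h Y Z) - S.h (S.nabla X Y) Z - S.h Y (S.nabla X Z)

/-- The curvature `R(X, Y)Z` of the surface. -/
def curvature (X Y Z : E → E) : E → E :=
  S.nabla X (S.nabla Y Z) - S.nabla Y (S.nabla X Z) - S.nabla (VectorField.lieBracket ℝ X Y) Z

/-- The curvature `R^D(X, Y)ξ` of the normal connection. -/
def normalCurvature (X Y : E → E) (ξ : E → W) : E → W :=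
  S.normalCov X (S.normalCov Y ξ) - S.normalCov Y (S.normalCov X ξ)
    - S.normalCov (VectorField.lieBracket ℝ X Y) ξ

/-- A smooth vector field on the coordinate domain. -/
def IsField (X : E → E) : Prop := ContDiffOn ℝ ∞ X S.dom

/-- A smooth normal field on the coordinate domain. -/
def IsNormalField (ξ : E → W) : Prop :=
  ContDiffOn ℝ ∞ ξ S.dom ∧ ∀ y ∈ S.dom, ∀ u, S.G y (ξ y) (S.ι y u) = 0

/-- The equation of Gauss at `x`, with ambient curvature `Rt` at `x`. -/
def GaussAt (Rt : W →L[ℝ] W →L[ℝ] W →L[ℝ] W) (x : E) : Prop :=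
  ∀ X Y Z T : E → E, S.IsField X → S.IsField Y → S.IsField Z → S.IsField T →
    S.g x (S.curvature X Y Z x) (T x) =
      S.G x (Rt (S.push X x) (S.push Y x) (S.push Z x)) (S.push T x)
        + S.G x (S.h X T x) (S.h Y Z x) - S.G x (S.h X Z x) (S.h Y T x)

/-- The equation of Codazzi at `x`, with ambient curvature `Rt` at `x`; the left-hand side is the
normal component of `Rt(X, Y)Z`. -/
def CodazziAt (Rt : W →L[ℝ] W →L[ℝ] W →L[ℝ] W) (x : E) : Prop :=
  ∀ X Y Z : E → E, S.IsField X → S.IsField Y → S.IsField Z →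
    S.normal (fun y => Rt (S.push X y) (S.push Y y) (S.push Z y)) x =
      S.nablaBarH X Y Z x - S.nablaBarH Y X Z x

/-- The equation of Ricci at `x`, with ambient curvature `Rt` at `x`. -/
def RicciAt (Rt : W →L[ℝ] W →L[ℝ] W →L[ℝ] W) (x : E) : Prop :=
  ∀ X Y : E → E, ∀ ξ η : E → W, S.IsField X → S.IsField Y →
    S.IsNormalField ξ → S.IsNormalField η →
    S.G x (S.normalCurvature X Y ξ x) (η x) =
      S.G x (Rt (S.push X x) (S.push Y x) (ξ x)) (η x)
        + S.g x ((S.shape ξ (S.shape η X) - S.shape η (S.shape ξ X)) x) (Y x)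

end SurfaceData

/-! ### Manifolds -/

section Manifold

variable (E : Type*) [NormedAddCommGroup E] [NormedSpace ℝ E]
  (M : Type*) [TopologicalSpace M] [ChartedSpace E M] [IsManifold 𝓘(ℝ, E) ∞ M]

/-- A smooth pseudo-Riemannian metric. -/
structure SmoothMetric where
  inner (p : M) : TangentSpace 𝓘(ℝ, E) p →L[ℝ] TangentSpace 𝓘(ℝ, E) p →L[ℝ] ℝ
  isScalarProduct (p : M) : IsScalarProduct (inner p)
  contMDiff : ContMDiff 𝓘(ℝ, E) (𝓘(ℝ, E).prod 𝓘(ℝ, E →L[ℝ] E →L[ℝ] ℝ)) ∞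
    (fun p : M => Bundle.TotalSpace.mk' (E →L[ℝ] E →L[ℝ] ℝ)
      (E := fun p : M => TangentSpace 𝓘(ℝ, E) p →L[ℝ] TangentSpace 𝓘(ℝ, E) p →L[ℝ] ℝ)
      p (inner p))

/-- A smooth field of endomorphisms of the tangent spaces. -/
structure EndField where
  toFun (p : M) : TangentSpace 𝓘(ℝ, E) p →L[ℝ] TangentSpace 𝓘(ℝ, E) p
  contMDiff : ContMDiff 𝓘(ℝ, E) (𝓘(ℝ, E).prod 𝓘(ℝ, E →L[ℝ] E)) ∞
    (fun p : M => Bundle.TotalSpace.mk' (E →L[ℝ] E)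
      (E := fun p : M => TangentSpace 𝓘(ℝ, E) p →L[ℝ] TangentSpace 𝓘(ℝ, E) p)
      p (toFun p))

variable {E M}

/-- The coordinate frame of the chart `e`, at the point with coordinates `x`. -/
def chartFrame (e : OpenPartialHomeomorph M E) (x : E) :
    E →L[ℝ] TangentSpace 𝓘(ℝ, E) (e.symm x) :=
  mfderiv 𝓘(ℝ, E) 𝓘(ℝ, E) e.symm x

/-- The dual coframe of the chart `e`, at the point with coordinates `x`. -/
def chartCoframe (e : OpenPartialHomeomorph M E) (x : E) :
    TangentSpace 𝓘(ℝ, E) (e.symm x) →L[ℝ] E :=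
  mfderiv 𝓘(ℝ, E) 𝓘(ℝ, E) e (e.symm x)

/-- The coordinate expression of a metric in the chart `e`. -/
def SmoothMetric.inChart (g : SmoothMetric E M) (e : OpenPartialHomeomorph M E) (x : E) :
    E →L[ℝ] E →L[ℝ] ℝ :=
  ((chartFrame e x).precomp ℝ).comp ((g.inner (e.symm x)).comp (chartFrame e x))

theorem SmoothMetric.inChart_apply (g : SmoothMetric E M) (e : OpenPartialHomeomorph M E) (x u v : E) :
    g.inChart e x u v = g.inner (e.symm x) (chartFrame e x u) (chartFrame e x v) := rfl

/-- The coordinate expression of a field of endomorphisms in the chart `e`. -/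
def EndField.inChart (J : EndField E M) (e : OpenPartialHomeomorph M E) (x : E) : E →L[ℝ] E :=
  (chartCoframe e x).comp ((J.toFun (e.symm x)).comp (chartFrame e x))

/-- `∇ J = 0` for the Levi-Civita connection `∇` of `g`, expressed in all smooth charts. -/
def IsParallel (g : SmoothMetric E M) (J : EndField E M) : Prop :=
  ∀ e ∈ IsManifold.maximalAtlas 𝓘(ℝ, E) ∞ M, ∀ x ∈ e.target, ∀ u v : E,
    fderiv ℝ (J.inChart e) x u v + christoffel (g.inChart e) x u (J.inChart e x v)
      - J.inChart e x (christoffel (g.inChart e) x u v) = 0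

/-- The metric `g` and the almost complex structure `J` are those of an indefinite Kaehler
manifold of complex index one. -/
structure IsLorentzianKaehler (g : SmoothMetric E M) (J : EndField E M) : Prop where
  hermitian (p : M) : IsLorentzHermitian (g.inner p) (J.toFun p)
  parallel : IsParallel g J

variable {W : Type*} [NormedAddCommGroup W] [NormedSpace ℝ W]
  {N : Type*} [TopologicalSpace N] [ChartedSpace W N] [IsManifold 𝓘(ℝ, W) ∞ N]

/-- A smooth isometric immersion. -/
structure IsIsometricImmersion (g : SmoothMetric E M) (gt : SmoothMetric W N) (φ : M → N) : Prop where
  smooth : ContMDiff 𝓘(ℝ, E) 𝓘(ℝ, W) ∞ φ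
  immersion (p : M) : Function.Injective (mfderiv 𝓘(ℝ, E) 𝓘(ℝ, W) φ p)
  isometric (p : M) (u v : TangentSpace 𝓘(ℝ, E) p) :
    gt.inner (φ p) (mfderiv 𝓘(ℝ, E) 𝓘(ℝ, W) φ p u) (mfderiv 𝓘(ℝ, E) 𝓘(ℝ, W) φ p v)
      = g.inner p u v

/-- The coordinate expression of a map. -/
def mapInCharts (φ : M → N) (e : OpenPartialHomeomorph M E) (e' : OpenPartialHomeomorph N W) :
    E → W := fun x => e' (φ (e.symm x))

/-- The geometry of an immersed submanifold in charts `e` of `M` and `e'` of `N`: the bundle is the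
pull-back of the tangent bundle of `N`, trivialised by the coordinate frame of `e'`, with the
pull-backs of the metric, of `J` and of the Levi-Civita connection; `ι` is the differential of the
immersion. -/
def immersionData (g : SmoothMetric E M) (gt : SmoothMetric W N) (J : EndField W N) (φ : M → N)
    (e : OpenPartialHomeomorph M E) (e' : OpenPartialHomeomorph N W) : SurfaceData E W where
  dom := e.target ∩ e.symm ⁻¹' (φ ⁻¹' e'.source)
  g := g.inChart e
  ι := fderiv ℝ (mapInCharts φ e e')
  G := fun x => gt.inChart e' (mapInCharts φ e e' x)
  J := fun x => J.inChart e' (mapInCharts φ e e' x)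
  θ := fun x => (christoffel (gt.inChart e') (mapInCharts φ e e' x)).comp
    (fderiv ℝ (mapInCharts φ e e') x)

/-- A tensorial equation for the immersion `φ`, given in coordinates as a relation between the
geometry of the immersion and the ambient curvature tensor, holds at the point `p`. -/
def HoldsAt (eqn : SurfaceData E W → (W →L[ℝ] W →L[ℝ] W →L[ℝ] W) → E → Prop)
    (g : SmoothMetric E M) (gt : SmoothMetric W N) (J : EndField W N) (φ : M → N) (p : M) : Prop :=
  ∀ e ∈ IsManifold.maximalAtlas 𝓘(ℝ, E) ∞ M, p ∈ e.source →
    ∀ e' ∈ IsManifold.maximalAtlas 𝓘(ℝ, W) ∞ N, φ p ∈ e'.source →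
      eqn (immersionData g gt J φ e e')
        (riemann (gt.inChart e') (mapInCharts φ e e' (e p))) (e p)

end Manifold

end LorentzKaehler

end

/-!
For `X`, `Y` tangent let `K(X, Y)` be the curvature of `∇̃`. The formulas of Gauss and Weingarten
express `K(X, Y)Z`, for `Z` tangent, by exactly the tangential and normal components that the
equations of Gauss and Codazzi prescribe for `R̃(X, Y)Z`, so `R̃(X, Y)` agrees with `K(X, Y)` on the
tangent space `T`. Both commute with `J`, hence they agree on `T + J T`, which is the whole fibre
because a Lorentz plane is not a complex line (a Hermitian metric is definite or zero on a complex
line). So `R̃(X, Y) = K(X, Y)`, and the equation of Ricci is the one that `K` satisfies.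
-/

noncomputable section

namespace LorentzKaehler

/-! ### Scalar products and generic subspaces -/

section LinearAlgebra

theorem IsScalarProduct.isInvertible {E : Type*} [NormedAddCommGroup E] [NormedSpace ℝ E]
    [FiniteDimensional ℝ E] {B : E →L[ℝ] E →L[ℝ] ℝ} (hB : IsScalarProduct B) :
    B.IsInvertible := by
  have hinj : Function.Injective (B : E →ₗ[ℝ] (E →L[ℝ] ℝ)) :=
    (injective_iff_map_eq_zero _).2 fun u hu => hB.nondegenerate u fun v => by
      rw [show B u = 0 from hu, _root_.zero_apply]
  have hdim : Module.finrank ℝ E = Module.finrank ℝ (E →L[ℝ] ℝ) := by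
    rw [← (LinearMap.toContinuousLinearMap (𝕜 := ℝ) (E := E) (F' := ℝ)).finrank_eq]
    exact (Subspace.dual_finrank_eq (K := ℝ) (V := E)).symm
  exact ⟨(LinearEquiv.ofInjectiveOfFinrankEq _ hinj hdim).toContinuousLinearEquiv, rfl⟩

theorem IsScalarProduct.apply_inverse {E : Type*} [NormedAddCommGroup E] [NormedSpace ℝ E]
    [FiniteDimensional ℝ E] {B : E →L[ℝ] E →L[ℝ] ℝ} (hB : IsScalarProduct B)
    (α : E →L[ℝ] ℝ) (w : E) : B (B.inverse α) w = α w := by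
  rw [hB.isInvertible.self_apply_inverse]

variable {V W : Type*} [AddCommGroup V] [Module ℝ V] [TopologicalSpace V]
  [AddCommGroup W] [Module ℝ W] [TopologicalSpace W]
  {B : V →L[ℝ] V →L[ℝ] ℝ} {G : W →L[ℝ] W →L[ℝ] ℝ} {J : W →L[ℝ] W} {P : V →L[ℝ] W}

theorem IsScalarProduct.ext (hB : IsScalarProduct B) {u v : V} (h : ∀ w, B u w = B v w) :
    u = v :=
  sub_eq_zero.1 <| hB.nondegenerate _ fun w => by rw [map_sub, _root_.sub_apply, h, sub_self]

theorem IsLorentzian.exists_apply_self_neg (hB : IsLorentzian B) : ∃ z, B z z < 0 := by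
  obtain ⟨N, hN, hN1⟩ := hB.1
  obtain ⟨z, hzN, hz⟩ : ∃ z ∈ N, z ≠ 0 := Submodule.exists_mem_ne_zero_of_ne_bot <| by
    rintro rfl
    simp at hN1
  exact ⟨z, hN z hzN hz⟩

theorem IsLorentzian.exists_apply_self_nonneg (hB : IsLorentzian B)
    (hV : 1 < Module.finrank ℝ V) : ∃ z ≠ 0, 0 ≤ B z z := by
  by_contra! h
  exact hV.not_ge (hB.2 ⟨⊤, fun z _ => h z, finrank_top ℝ V⟩)

/-- On a plane, a symmetric form with an orthogonal basis of vectors of equal square is definite or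
zero. -/
theorem IsLorentzian.not_linearIndependent_pair (hB : IsLorentzian B)
    (hV : Module.finrank ℝ V = 2) (hsymm : ∀ u v, B u v = B v u) {u v : V} (huv : B u v = 0)
    (hsq : B u u = B v v) : ¬ LinearIndependent ℝ ![u, v] := by
  intro hind
  have hform : ∀ z, ∃ a b : ℝ, z = a • u + b • v ∧ B z z = B v v * (a ^ 2 + b ^ 2) := by
    intro z
    have hz : z ∈ Submodule.span ℝ (Set.range ![u, v]) := by
      rw [hind.span_eq_top_of_card_eq_finrank (by simp [hV])]
      trivial
    rw [Matrix.range_cons, Matrix.range_cons, Matrix.range_empty, Set.union_empty,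
      Set.singleton_union, Submodule.mem_span_pair] at hz
    obtain ⟨a, b, rfl⟩ := hz
    refine ⟨a, b, rfl, ?_⟩
    simp only [map_add, map_smul, _root_.add_apply, _root_.smul_apply, smul_eq_mul, hsymm v u,
      huv, hsq]
    ring
  obtain ⟨z, hz⟩ := hB.exists_apply_self_neg
  obtain ⟨a, b, -, hab⟩ := hform z
  have hneg : B v v < 0 := by
    by_contra! h
    exact hz.not_ge (hab ▸ by positivity)
  obtain ⟨z, hz0, hz⟩ := hB.exists_apply_self_nonneg (by rw [hV]; norm_num)
  obtain ⟨a, b, rfl, hab⟩ := hform z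
  rw [hab] at hz
  have hzero : a ^ 2 + b ^ 2 ≤ 0 := nonpos_of_mul_nonneg_right hz hneg
  have ha : a = 0 := by nlinarith [sq_nonneg a, sq_nonneg b]
  have hb : b = 0 := by nlinarith [sq_nonneg a, sq_nonneg b]
  exact hz0 (by rw [ha, hb, zero_smul, zero_smul, add_zero])

theorem linearIndependent_pair_of_sq_eq_neg (hJ : ∀ w, J (J w) = -w) {w : W} (hw : w ≠ 0) :
    LinearIndependent ℝ ![w, J w] := by
  rw [LinearIndependent.pair_iff]
  intro a b hab
  have hJab : a • J w - b • w = 0 := by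
    have := congrArg J hab
    simpa only [map_add, map_smul, hJ, smul_neg, ← sub_eq_add_neg, map_zero] using this
  have h : (a ^ 2 + b ^ 2) • w = 0 := by
    calc (a ^ 2 + b ^ 2) • w = a • (a • w + b • J w) - b • (a • J w - b • w) := by module
      _ = 0 := by rw [hab, hJab, smul_zero, smul_zero, sub_zero]
  have hzero := (smul_eq_zero.1 h).resolve_right hw
  constructor <;> nlinarith [sq_nonneg a, sq_nonneg b]

/-- The range `T` of `P` is generic for the endomorphism `J`, in the sense of CR geometry:
`T + J T` is the whole space. -/
def IsGeneric (J : W →L[ℝ] W) (P : V →L[ℝ] W) : Prop :=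
  ∀ w, ∃ u v, w = P u + J (P v)

theorem isGeneric_of_finrank_eq (hV : 0 < Module.finrank ℝ V)
    (hdim : Module.finrank ℝ W = 2 * Module.finrank ℝ V) (hP : Function.Injective P)
    (hreal : ∀ u v, P u = J (P v) → v = 0) : IsGeneric J P := by
  have : FiniteDimensional ℝ V := .of_finrank_pos hV
  have : FiniteDimensional ℝ W := .of_finrank_pos (by lia)
  let L : V × V →ₗ[ℝ] W := (P : V →ₗ[ℝ] W).coprod ((J : W →ₗ[ℝ] W) ∘ₗ (P : V →ₗ[ℝ] W))
  have hinj : Function.Injective L := by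
    refine (injective_iff_map_eq_zero _).2 ?_
    rintro ⟨u, v⟩ (huv : P u + J (P v) = 0)
    obtain rfl : v = 0 := hreal (-u) v (by rw [map_neg, eq_comm, eq_neg_of_add_eq_zero_right huv])
    rw [map_zero, map_zero, add_zero] at huv
    rw [(map_eq_zero_iff P hP).1 huv, Prod.mk_zero_zero]
  have hsurj : Function.Surjective L :=
    (LinearMap.injective_iff_surjective_of_finrank_eq_finrank
      (by rw [Module.finrank_prod]; lia)).1 hinj
  intro w
  obtain ⟨⟨u, v⟩, h⟩ := hsurj w
  exact ⟨u, v, h.symm⟩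

theorem IsLorentzian.isGeneric (hV : Module.finrank ℝ V = 2) (hW : Module.finrank ℝ W = 4)
    (hl : IsLorentzian B) (hB : IsScalarProduct B) (hG : ∀ a b, G a b = G b a)
    (hJ : ∀ w, J (J w) = -w) (hH : ∀ a b, G (J a) (J b) = G a b)
    (hP : ∀ u v, G (P u) (P v) = B u v) : IsGeneric J P := by
  have hPinj : Function.Injective P := (injective_iff_map_eq_zero P).2 fun u hu =>
    hB.nondegenerate u fun v => by rw [← hP, hu, map_zero, _root_.zero_apply]
  refine isGeneric_of_finrank_eq (by lia) (by lia) hPinj fun u v huv => ?_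
  by_contra hv
  have hskew : G (P v) (J (P v)) = 0 := by
    have h := hH (P v) (J (P v))
    rw [hJ, map_neg, hG (J (P v))] at h
    linarith
  refine hl.not_linearIndependent_pair hV hB.symm (u := v) (v := u) ?_ ?_
    (LinearIndependent.of_comp (P : V →ₗ[ℝ] W) ?_)
  · rw [← hP, huv, hskew]
  · rw [← hP, ← hP, huv, hH]
  · have hcomp : ⇑(P : V →ₗ[ℝ] W) ∘ ![v, u] = ![P v, J (P v)] := by
      rw [← huv]
      ext i
      fin_cases i <;> rfl
    rw [hcomp]
    exact linearIndependent_pair_of_sq_eq_neg hJ ((map_ne_zero_iff P hPinj).2 hv)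

theorem IsKaehlerCurvature.apply_complex [IsTopologicalAddGroup W] [ContinuousSMul ℝ W]
    {R : W →L[ℝ] W →L[ℝ] W →L[ℝ] W}
    (hR : IsKaehlerCurvature G J R) (hG : IsScalarProduct G) (hJ : IsLorentzHermitian G J)
    (X Y Z : W) : R X Y (J Z) = J (R X Y Z) :=
  hG.ext fun T => by
    rw [hR.complex, ← hJ.hermitian (R X Y Z), hJ.sq, map_neg, neg_neg]

end LinearAlgebra

/-! ### Connections on trivial bundles -/

section Connection

open scoped Topology

variable {E F F' W : Type*} [NormedAddCommGroup E] [NormedSpace ℝ E]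
  [NormedAddCommGroup F] [NormedSpace ℝ F] [NormedAddCommGroup F'] [NormedSpace ℝ F']
  [NormedAddCommGroup W] [NormedSpace ℝ W] {x : E}

theorem fderiv_clm_apply_apply {A : E → F →L[ℝ] W} {V : E → F}
    (hA : DifferentiableAt ℝ A x) (hV : DifferentiableAt ℝ V x) (u : E) :
    fderiv ℝ (fun y => A y (V y)) x u = fderiv ℝ A x u (V x) + A x (fderiv ℝ V x u) := by
  rw [fderiv_clm_apply hA hV]
  exact add_comm _ _

theorem fderiv_clm_apply_const {A : E → F →L[ℝ] W} (hA : DifferentiableAt ℝ A x) (u : E) (v : F) :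
    fderiv ℝ (fun y => A y v) x u = fderiv ℝ A x u v := by
  rw [fderiv_clm_apply_apply hA (differentiableAt_const v), fderiv_fun_const, Pi.zero_apply,
    _root_.zero_apply, map_zero, add_zero]

theorem fderiv_clm_apply_const₂ {A : E → F →L[ℝ] F' →L[ℝ] W} (hA : DifferentiableAt ℝ A x)
    (u : E) (v : F) (w : F') : fderiv ℝ (fun y => A y v w) x u = fderiv ℝ A x u v w := by
  rw [fderiv_clm_apply_const (by fun_prop), fderiv_clm_apply_const hA]

theorem fderiv_fderiv_comm {f : E → F} (hf : ContDiffAt ℝ 2 f x) (u v : E) :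
    fderiv ℝ (fderiv ℝ f) x u v = fderiv ℝ (fderiv ℝ f) x v u :=
  hf.isSymmSndFDerivAt (by rw [minSmoothness_of_isRCLikeNormedField]) u v

/-- The covariant derivative `∇_X V` for the connection `∇ = d + θ` of a trivial bundle. Both
`SurfaceData.covAmbient` and `SurfaceData.nabla` are instances by definition. -/
def covDeriv (θ : E → E →L[ℝ] W →L[ℝ] W) (X : E → E) (V : E → W) : E → W :=
  fun x => fderiv ℝ V x (X x) + θ x (X x) (V x)

/-- The curvature tensor `dθ + θ ∧ θ` of the connection `d + θ`, of which `riemann` is the case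
`θ = christoffel g`. -/
def connCurvature (θ : E → E →L[ℝ] W →L[ℝ] W) (x : E) : E →L[ℝ] E →L[ℝ] W →L[ℝ] W :=
  fderiv ℝ θ x - (fderiv ℝ θ x).flip
    + (ContinuousLinearMap.compL ℝ W W W).bilinearComp (θ x) (θ x)
    - ((ContinuousLinearMap.compL ℝ W W W).bilinearComp (θ x) (θ x)).flip

theorem connCurvature_apply (θ : E → E →L[ℝ] W →L[ℝ] W) (x u v : E) (w : W) :
    connCurvature θ x u v w =
      fderiv ℝ θ x u v w - fderiv ℝ θ x v u w + θ x u (θ x v w) - θ x v (θ x u w) := by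
  simp [connCurvature]

variable {θ : E → E →L[ℝ] W →L[ℝ] W} {X Y : E → E} {V V' : E → W}

theorem covDeriv_add (hV : DifferentiableAt ℝ V x) (hV' : DifferentiableAt ℝ V' x) :
    covDeriv θ X (V + V') x = covDeriv θ X V x + covDeriv θ X V' x := by
  simp only [covDeriv, fderiv_add hV hV', Pi.add_apply, map_add, _root_.add_apply]
  abel

theorem covDeriv_sub (hV : DifferentiableAt ℝ V x) (hV' : DifferentiableAt ℝ V' x) :
    covDeriv θ X (V - V') x = covDeriv θ X V x - covDeriv θ X V' x := by
  simp only [covDeriv, fderiv_sub hV hV', Pi.sub_apply, map_sub, _root_.sub_apply]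
  abel

theorem covDeriv_congr (h : V =ᶠ[𝓝 x] V') : covDeriv θ X V x = covDeriv θ X V' x := by
  rw [covDeriv, covDeriv, h.fderiv_eq, h.eq_of_nhds]

theorem contDiffOn_covDeriv {s : Set E} (hs : IsOpen s) (hθ : ContDiffOn ℝ ∞ θ s)
    (hX : ContDiffOn ℝ ∞ X s) (hV : ContDiffOn ℝ ∞ V s) : ContDiffOn ℝ ∞ (covDeriv θ X V) s :=
  ((hV.fderiv_of_isOpen hs le_rfl).clm_apply hX).add ((hθ.clm_apply hX).clm_apply hV)

theorem fderiv_covDeriv_apply (hθ : DifferentiableAt ℝ θ x) (hX : DifferentiableAt ℝ X x)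
    (hV : ContDiffAt ℝ 2 V x) (u : E) :
    fderiv ℝ (covDeriv θ X V) x u =
      fderiv ℝ (fderiv ℝ V) x u (X x) + fderiv ℝ V x (fderiv ℝ X x u)
        + (fderiv ℝ θ x u (X x) (V x) + θ x (fderiv ℝ X x u) (V x)
          + θ x (X x) (fderiv ℝ V x u)) := by
  have hV₁ : DifferentiableAt ℝ V x := hV.differentiableAt two_ne_zero
  have hV₂ : DifferentiableAt ℝ (fderiv ℝ V) x :=
    (hV.fderiv_right (m := 1) (by norm_num)).differentiableAt one_ne_zero
  unfold covDeriv
  rw [fderiv_fun_add (by fun_prop) (by fun_prop), _root_.add_apply,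
    fderiv_clm_apply_apply hV₂ hX, fderiv_clm_apply_apply (by fun_prop) hV₁,
    fderiv_clm_apply_apply hθ hX, _root_.add_apply]

theorem covDeriv_commutator (hθ : DifferentiableAt ℝ θ x) (hX : DifferentiableAt ℝ X x)
    (hY : DifferentiableAt ℝ Y x) (hV : ContDiffAt ℝ 2 V x) :
    covDeriv θ X (covDeriv θ Y V) x - covDeriv θ Y (covDeriv θ X V) x
        - covDeriv θ (VectorField.lieBracket ℝ X Y) V x
      = connCurvature θ x (X x) (Y x) (V x) := by
  have hcov : ∀ (Z : E → E) (U : E → W),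
      covDeriv θ Z U x = fderiv ℝ U x (Z x) + θ x (Z x) (U x) := fun _ _ => rfl
  rw [hcov X (covDeriv θ Y V), hcov Y (covDeriv θ X V), fderiv_covDeriv_apply hθ hY hV,
    fderiv_covDeriv_apply hθ hX hV, fderiv_fderiv_comm hV (Y x)]
  simp only [hcov, VectorField.lieBracket, connCurvature_apply, map_add, map_sub,
    _root_.sub_apply]
  abel

theorem covDeriv_apply_of_parallel {J : E → W →L[ℝ] W} (hJ : DifferentiableAt ℝ J x)
    (hp : ∀ u a, fderiv ℝ J x u a + θ x u (J x a) = J x (θ x u a))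
    (hV : DifferentiableAt ℝ V x) :
    covDeriv θ X (fun y => J y (V y)) x = J x (covDeriv θ X V x) := by
  rw [covDeriv, fderiv_clm_apply_apply hJ hV, add_right_comm, hp, ← map_add, add_comm, covDeriv]

theorem connCurvature_apply_of_parallel {J : E → W →L[ℝ] W} (hθ : DifferentiableAt ℝ θ x)
    (hJ : ContDiffAt ℝ 2 J x)
    (hp : ∀ᶠ y in 𝓝 x, ∀ u a, fderiv ℝ J y u a + θ y u (J y a) = J y (θ y u a))
    (u v : E) (a : W) :
    connCurvature θ x u v (J x a) = J x (connCurvature θ x u v a) := by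
  have hJ₁ : ∀ᶠ y in 𝓝 x, DifferentiableAt ℝ J y :=
    (hJ.eventually (by simp)).mono fun y hy => hy.differentiableAt two_ne_zero
  have hcov : ∀ v w : E, covDeriv θ (fun _ => v) (covDeriv θ (fun _ => w) fun y => J y a) x
      = J x (covDeriv θ (fun _ => v) (covDeriv θ (fun _ => w) fun _ => a) x) := by
    intro v w
    have hcomm : covDeriv θ (fun _ => w) (fun y => J y a)
        =ᶠ[𝓝 x] fun y => J y (covDeriv θ (fun _ => w) (fun _ => a) y) := by
      filter_upwards [hp, hJ₁] with y hpy hJy using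
        covDeriv_apply_of_parallel hJy hpy (differentiableAt_const a)
    have ha : DifferentiableAt ℝ (covDeriv θ (fun _ => w) fun _ => a) x := by
      unfold covDeriv
      fun_prop
    rw [covDeriv_congr hcomm, covDeriv_apply_of_parallel hJ₁.self_of_nhds hp.self_of_nhds ha]
  have hbr : ∀ V : E → W,
      covDeriv θ (VectorField.lieBracket ℝ (fun _ => u) (fun _ => v)) V x = 0 := by
    simp [covDeriv, VectorField.lieBracket]
  have hcommutator {V : E → W} (hV : ContDiffAt ℝ 2 V x) :=
    covDeriv_commutator hθ (differentiableAt_const u) (differentiableAt_const v) hV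
  rw [← hcommutator (V := fun y => J y a) (by fun_prop),
    ← hcommutator (V := fun _ => a) contDiffAt_const, hcov, hcov, hbr, hbr, sub_zero, sub_zero,
    map_sub]

end Connection

/-! ### The Levi-Civita connection -/

section LeviCivita

open scoped Topology

variable {E : Type*} [NormedAddCommGroup E] [NormedSpace ℝ E]
  {g : E → E →L[ℝ] E →L[ℝ] ℝ} {x : E}

theorem connCurvature_christoffel : connCurvature (christoffel g) x = riemann g x := rfl

theorem fderiv_metric_symm (hg : DifferentiableAt ℝ g x)
    (hsymm : ∀ᶠ y in 𝓝 x, ∀ u v, g y u v = g y v u) (u v w : E) :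
    fderiv ℝ g x u v w = fderiv ℝ g x u w v := by
  have h : (fun y => g y v w) =ᶠ[𝓝 x] fun y => g y w v := hsymm.mono fun y hy => hy v w
  rw [← fderiv_clm_apply_const₂ hg, ← fderiv_clm_apply_const₂ hg, h.fderiv_eq]

theorem christoffel_symm (hg : DifferentiableAt ℝ g x)
    (hsymm : ∀ᶠ y in 𝓝 x, ∀ u v, g y u v = g y v u) (u v : E) :
    christoffel g x u v = christoffel g x v u := by
  have h : koszul g x u v = koszul g x v u := by
    ext w
    rw [koszul_apply, koszul_apply, fderiv_metric_symm hg hsymm w u v]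
    ring
  rw [christoffel_apply, christoffel_apply, h]

/-- Uniqueness of the Levi-Civita connection: `B u v w` stands for `g(∇_u v, w)`. -/
theorem koszul_eq_of_symm {B : E → E → E → ℝ} (hsymm : ∀ u v w, B u v w = B v u w)
    (hmetric : ∀ u v w, fderiv ℝ g x u v w = B u v w + B u w v) (u v w : E) :
    koszul g x u v w = B u v w := by
  rw [koszul_apply, hmetric, hmetric, hmetric, hsymm v u w, hsymm w u v, hsymm w v u]
  ring

theorem contDiffOn_koszul {s : Set E} (hs : IsOpen s) (hg : ContDiffOn ℝ ∞ g s) :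
    ContDiffOn ℝ ∞ (koszul g) s := by
  have hd : ContDiffOn ℝ ∞ (fderiv ℝ g) s := hg.fderiv_of_isOpen hs le_rfl
  have hflip : ContDiffOn ℝ ∞ (fun y => (fderiv ℝ g y).flip) s :=
    (ContinuousLinearMap.flipₗᵢ ℝ E E (E →L[ℝ] ℝ)).toContinuousLinearEquiv.contDiff.comp_contDiffOn
      hd
  exact ((hd.add hflip).sub (contDiffOn_const.clm_comp hflip)).const_smul (1 / 2 : ℝ)

variable [FiniteDimensional ℝ E]

theorem apply_christoffel (hsc : IsScalarProduct (g x)) (u v w : E) :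
    g x (christoffel g x u v) w = koszul g x u v w := by
  rw [christoffel_apply, hsc.apply_inverse]

theorem fderiv_metric_eq (hg : DifferentiableAt ℝ g x)
    (hsc : ∀ᶠ y in 𝓝 x, IsScalarProduct (g y)) (u v w : E) :
    fderiv ℝ g x u v w = g x (christoffel g x u v) w + g x v (christoffel g x u w) := by
  have hx := hsc.self_of_nhds
  rw [hx.symm v, apply_christoffel hx, apply_christoffel hx, koszul_apply, koszul_apply,
    fderiv_metric_symm hg (hsc.mono fun _ hy => hy.symm) u w v]
  ring

theorem contDiffOn_inverse {s : Set E} (hg : ContDiffOn ℝ ∞ g s)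
    (hsc : ∀ y ∈ s, IsScalarProduct (g y)) : ContDiffOn ℝ ∞ (fun y => (g y).inverse) s := by
  have : CompleteSpace E := FiniteDimensional.complete ℝ E
  intro y hy
  exact (hsc y hy).isInvertible.contDiffAt_map_inverse.comp_contDiffWithinAt y (hg y hy)

theorem contDiffOn_christoffel {s : Set E} (hs : IsOpen s) (hg : ContDiffOn ℝ ∞ g s)
    (hsc : ∀ y ∈ s, IsScalarProduct (g y)) : ContDiffOn ℝ ∞ (christoffel g) s :=
  ((ContinuousLinearMap.compL ℝ E (E →L[ℝ] ℝ) E).contDiff.comp_contDiffOn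
    (contDiffOn_inverse hg hsc)).clm_comp (contDiffOn_koszul hs hg)

end LeviCivita

/-! ### The fundamental equations -/

namespace SurfaceData

variable {E W : Type*} [NormedAddCommGroup E] [NormedSpace ℝ E]
  [NormedAddCommGroup W] [NormedSpace ℝ W] {S : SurfaceData E W} {x : E}

/-- The part of `SurfaceData.IsLorentzKaehler` that concerns neither `J` nor the index of the
metrics: a pseudo-Riemannian submanifold datum of arbitrary dimension and codimension. -/
structure IsPseudoRiemannian (S : SurfaceData E W) : Prop where
  isOpen : IsOpen S.dom
  smooth_g : ContDiffOn ℝ ∞ S.g S.dom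
  smooth_ι : ContDiffOn ℝ ∞ S.ι S.dom
  smooth_G : ContDiffOn ℝ ∞ S.G S.dom
  smooth_θ : ContDiffOn ℝ ∞ S.θ S.dom
  scalar_g : ∀ x ∈ S.dom, IsScalarProduct (S.g x)
  scalar_G : ∀ x ∈ S.dom, IsScalarProduct (S.G x)
  isometric : ∀ x ∈ S.dom, ∀ u v, S.G x (S.ι x u) (S.ι x v) = S.g x u v
  parallel_G : ∀ x ∈ S.dom, ∀ u a b,
    fderiv ℝ S.G x u a b = S.G x (S.θ x u a) b + S.G x a (S.θ x u b)
  torsion_free : ∀ x ∈ S.dom, ∀ u v,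
    fderiv ℝ S.ι x u v + S.θ x u (S.ι x v) = fderiv ℝ S.ι x v u + S.θ x v (S.ι x u)

/-- The endomorphism field `J` is smooth and `∇̃ J = 0`. It need not be a complex structure. -/
structure HasParallelJ (S : SurfaceData E W) : Prop where
  smooth : ContDiffOn ℝ ∞ S.J S.dom
  parallel : ∀ x ∈ S.dom, ∀ u a,
    fderiv ℝ S.J x u a + S.θ x u (S.J x a) = S.J x (S.θ x u a)

/-- The second fundamental form as a tensor on the coordinate space, see `h_eq_secondForm`. -/
def secondForm (S : SurfaceData E W) (x u v : E) : W :=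
  fderiv ℝ S.ι x u v + S.θ x u (S.ι x v) - S.ι x (christoffel S.g x u v)

theorem push_tangential_add_normal (V : E → W) : S.push (S.tangential V) + S.normal V = V :=
  add_sub_cancel _ _

theorem covAmbient_push (X Y : E → E) :
    S.covAmbient X (S.push Y) = S.push (S.nabla X Y) + S.h X Y :=
  (add_sub_cancel _ _).symm

theorem covAmbient_eq_normalCov_sub_push_shape (X : E → E) (ξ : E → W) :
    S.covAmbient X ξ = S.normalCov X ξ - S.push (S.shape ξ X) := by
  ext y
  simp [normalCov, normal, shape, push]

theorem h_sub_left (X X' Y : E → E) : S.h (X - X') Y x = S.h X Y x - S.h X' Y x := by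
  simp only [h, covAmbient, push, nabla, Pi.sub_apply, map_add, map_sub, _root_.sub_apply]
  abel

theorem h_congr_left {X X' : E → E} (hX : X x = X' x) (Y : E → E) : S.h X Y x = S.h X' Y x := by
  simp only [h, covAmbient, push, nabla, Pi.sub_apply, hX]

namespace IsPseudoRiemannian

variable {X Y Z : E → E} {V V' ξ η : E → W}

theorem differentiableAt {F : Type*} [NormedAddCommGroup F] [NormedSpace ℝ F] {f : E → F}
    (hS : S.IsPseudoRiemannian) (hf : ContDiffOn ℝ ∞ f S.dom) (hx : x ∈ S.dom) :
    DifferentiableAt ℝ f x :=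
  (hf.contDiffAt (hS.isOpen.mem_nhds hx)).differentiableAt (by simp)

theorem contDiffOn_push (hS : S.IsPseudoRiemannian) (hY : S.IsField Y) :
    ContDiffOn ℝ ∞ (S.push Y) S.dom :=
  hS.smooth_ι.clm_apply hY

theorem contDiffOn_covAmbient (hS : S.IsPseudoRiemannian) (hX : S.IsField X)
    (hV : ContDiffOn ℝ ∞ V S.dom) : ContDiffOn ℝ ∞ (S.covAmbient X V) S.dom :=
  contDiffOn_covDeriv hS.isOpen hS.smooth_θ hX hV

theorem covAmbient_add (hS : S.IsPseudoRiemannian) (hx : x ∈ S.dom) (X : E → E)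
    (hV : ContDiffOn ℝ ∞ V S.dom) (hV' : ContDiffOn ℝ ∞ V' S.dom) :
    S.covAmbient X (V + V') x = S.covAmbient X V x + S.covAmbient X V' x :=
  covDeriv_add (hS.differentiableAt hV hx) (hS.differentiableAt hV' hx)

theorem covAmbient_sub (hS : S.IsPseudoRiemannian) (hx : x ∈ S.dom) (X : E → E)
    (hV : ContDiffOn ℝ ∞ V S.dom) (hV' : ContDiffOn ℝ ∞ V' S.dom) :
    S.covAmbient X (V - V') x = S.covAmbient X V x - S.covAmbient X V' x :=
  covDeriv_sub (hS.differentiableAt hV hx) (hS.differentiableAt hV' hx)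

theorem covAmbient_commutator (hS : S.IsPseudoRiemannian) (hx : x ∈ S.dom) (hX : S.IsField X)
    (hY : S.IsField Y) (hV : ContDiffOn ℝ ∞ V S.dom) :
    S.covAmbient X (S.covAmbient Y V) x - S.covAmbient Y (S.covAmbient X V) x
        - S.covAmbient (VectorField.lieBracket ℝ X Y) V x
      = connCurvature S.θ x (X x) (Y x) (V x) :=
  covDeriv_commutator (hS.differentiableAt hS.smooth_θ hx) (hS.differentiableAt hX hx)
    (hS.differentiableAt hY hx) ((hV.contDiffAt (hS.isOpen.mem_nhds hx)).of_le ENat.LEInfty.out)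

theorem fderiv_metric_apply (hS : S.IsPseudoRiemannian) (hx : x ∈ S.dom) (X : E → E)
    (hV : ContDiffOn ℝ ∞ V S.dom) (hV' : ContDiffOn ℝ ∞ V' S.dom) :
    fderiv ℝ (fun y => S.G y (V y) (V' y)) x (X x) =
      S.G x (S.covAmbient X V x) (V' x) + S.G x (V x) (S.covAmbient X V' x) := by
  have dG := hS.differentiableAt hS.smooth_G hx
  have dV := hS.differentiableAt hV hx
  rw [fderiv_clm_apply_apply (by fun_prop) (hS.differentiableAt hV' hx),
    fderiv_clm_apply_apply dG dV, _root_.add_apply, hS.parallel_G x hx]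
  simp only [covAmbient, map_add, _root_.add_apply]
  ring

theorem metric_covAmbient_eq_neg (hS : S.IsPseudoRiemannian) (hx : x ∈ S.dom) (X : E → E)
    (hV : ContDiffOn ℝ ∞ V S.dom) (hV' : ContDiffOn ℝ ∞ V' S.dom)
    (horth : ∀ y ∈ S.dom, S.G y (V y) (V' y) = 0) :
    S.G x (S.covAmbient X V x) (V' x) = -S.G x (V x) (S.covAmbient X V' x) := by
  have hzero : (fun y => S.G y (V y) (V' y)) =ᶠ[nhds x] fun _ => 0 :=
    Filter.eventuallyEq_of_mem (hS.isOpen.mem_nhds hx) horth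
  have h := hS.fderiv_metric_apply hx X hV hV'
  rw [hzero.fderiv_eq, fderiv_fun_const, Pi.zero_apply, _root_.zero_apply] at h
  exact eq_neg_of_add_eq_zero_left h.symm

theorem christoffel_symm (hS : S.IsPseudoRiemannian) (hx : x ∈ S.dom) (u v : E) :
    christoffel S.g x u v = christoffel S.g x v u :=
  LorentzKaehler.christoffel_symm (hS.differentiableAt hS.smooth_g hx)
    (Filter.mem_of_superset (hS.isOpen.mem_nhds hx) fun y hy => (hS.scalar_g y hy).symm) u v

theorem h_eq_secondForm (hS : S.IsPseudoRiemannian) (hx : x ∈ S.dom) (X : E → E)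
    (hY : S.IsField Y) : S.h X Y x = S.secondForm x (X x) (Y x) := by
  have hpush : fderiv ℝ (S.push Y) x (X x)
      = fderiv ℝ S.ι x (X x) (Y x) + S.ι x (fderiv ℝ Y x (X x)) :=
    fderiv_clm_apply_apply (hS.differentiableAt hS.smooth_ι hx) (hS.differentiableAt hY hx) _
  simp only [h, Pi.sub_apply, covAmbient, hpush, secondForm, push, nabla, map_add]
  abel

theorem secondForm_symm (hS : S.IsPseudoRiemannian) (hx : x ∈ S.dom) (u v : E) :
    S.secondForm x u v = S.secondForm x v u := by
  rw [secondForm, secondForm, hS.torsion_free x hx u v, hS.christoffel_symm hx u v]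

theorem h_symm (hS : S.IsPseudoRiemannian) (hx : x ∈ S.dom) (hX : S.IsField X)
    (hY : S.IsField Y) : S.h X Y x = S.h Y X x := by
  rw [hS.h_eq_secondForm hx X hY, hS.h_eq_secondForm hx Y hX, hS.secondForm_symm hx]

theorem h_lieBracket (hS : S.IsPseudoRiemannian) (hx : x ∈ S.dom) (X Y Z : E → E) :
    S.h (VectorField.lieBracket ℝ X Y) Z x = S.h (S.nabla X Y) Z x - S.h (S.nabla Y X) Z x := by
  have htorsion : VectorField.lieBracket ℝ X Y x = (S.nabla X Y - S.nabla Y X) x := by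
    simp only [nabla, VectorField.lieBracket, Pi.sub_apply, hS.christoffel_symm hx (X x) (Y x)]
    abel
  rw [h_congr_left htorsion, h_sub_left]

theorem metric_normal_apply (hS : S.IsPseudoRiemannian) (hx : x ∈ S.dom) (V : E → W)
    (hη : S.IsNormalField η) : S.G x (S.normal V x) (η x) = S.G x (V x) (η x) := by
  rw [normal, Pi.sub_apply, map_sub, _root_.sub_apply, push, (hS.scalar_G x hx).symm (S.ι x _),
    hη.2 x hx, sub_zero]

variable [FiniteDimensional ℝ E]

theorem secondForm_normal (hS : S.IsPseudoRiemannian) (hx : x ∈ S.dom) (u v w : E) :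
    S.G x (S.secondForm x u v) (S.ι x w) = 0 := by
  have dι := hS.differentiableAt hS.smooth_ι hx
  let B : E → E → E → ℝ := fun a b c =>
    S.G x (fderiv ℝ S.ι x a b + S.θ x a (S.ι x b)) (S.ι x c)
  have hsymm : ∀ a b c, B a b c = B b a c := fun a b c => by
    simp only [B, hS.torsion_free x hx a b]
  have hmetric : ∀ a b c, fderiv ℝ S.g x a b c = B a b c + B a c b := by
    intro a b c
    have hiso : (fun y => S.g y b c) =ᶠ[nhds x] fun y => S.G y (S.ι y b) (S.ι y c) :=
      Filter.eventuallyEq_of_mem (hS.isOpen.mem_nhds hx) fun y hy => (hS.isometric y hy b c).symm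
    rw [← fderiv_clm_apply_const₂ (hS.differentiableAt hS.smooth_g hx), hiso.fderiv_eq,
      hS.fderiv_metric_apply hx (fun _ => a) (hS.smooth_ι.clm_apply contDiffOn_const)
        (hS.smooth_ι.clm_apply contDiffOn_const), (hS.scalar_G x hx).symm (S.ι x b)]
    simp only [covAmbient, fderiv_clm_apply_const dι, B]
  rw [secondForm, map_sub, _root_.sub_apply, hS.isometric x hx,
    apply_christoffel (hS.scalar_g x hx), koszul_eq_of_symm hsymm hmetric, sub_self]

theorem isField_nabla (hS : S.IsPseudoRiemannian) (hX : S.IsField X) (hY : S.IsField Y) :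
    S.IsField (S.nabla X Y) :=
  contDiffOn_covDeriv hS.isOpen (contDiffOn_christoffel hS.isOpen hS.smooth_g hS.scalar_g) hX hY

theorem contDiffOn_h (hS : S.IsPseudoRiemannian) (hX : S.IsField X) (hY : S.IsField Y) :
    ContDiffOn ℝ ∞ (S.h X Y) S.dom :=
  (hS.contDiffOn_covAmbient hX (hS.contDiffOn_push hY)).sub
    (hS.contDiffOn_push (hS.isField_nabla hX hY))

theorem isNormalField_h (hS : S.IsPseudoRiemannian) (hX : S.IsField X) (hY : S.IsField Y) :
    S.IsNormalField (S.h X Y) :=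
  ⟨hS.contDiffOn_h hX hY, fun y hy u => by
    rw [hS.h_eq_secondForm hy X hY, hS.secondForm_normal hy]⟩

theorem isField_tangential (hS : S.IsPseudoRiemannian) (hV : ContDiffOn ℝ ∞ V S.dom) :
    S.IsField (S.tangential V) :=
  (contDiffOn_inverse hS.smooth_g hS.scalar_g).clm_apply
    ((hS.smooth_G.clm_apply hV).clm_comp hS.smooth_ι)

theorem isField_shape (hS : S.IsPseudoRiemannian) (hξ : ContDiffOn ℝ ∞ ξ S.dom)
    (hX : S.IsField X) : S.IsField (S.shape ξ X) :=
  (hS.isField_tangential (hS.contDiffOn_covAmbient hX hξ)).neg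

theorem contDiffOn_normalCov (hS : S.IsPseudoRiemannian) (hξ : ContDiffOn ℝ ∞ ξ S.dom)
    (hX : S.IsField X) : ContDiffOn ℝ ∞ (S.normalCov X ξ) S.dom :=
  (hS.contDiffOn_covAmbient hX hξ).sub
    (hS.contDiffOn_push (hS.isField_tangential (hS.contDiffOn_covAmbient hX hξ)))

theorem metric_tangential (hS : S.IsPseudoRiemannian) (hx : x ∈ S.dom) (V : E → W) (w : E) :
    S.g x (S.tangential V x) w = S.G x (V x) (S.ι x w) :=
  (hS.scalar_g x hx).apply_inverse _ w

theorem metric_shape (hS : S.IsPseudoRiemannian) (hx : x ∈ S.dom) (hξ : S.IsNormalField ξ)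
    (X : E → E) (hY : S.IsField Y) :
    S.g x (S.shape ξ X x) (Y x) = S.G x (ξ x) (S.h X Y x) := by
  have h := hS.metric_covAmbient_eq_neg hx X hξ.1 (hS.contDiffOn_push hY)
    fun y hy => hξ.2 y hy (Y y)
  rw [covAmbient_push, Pi.add_apply, map_add, push, push, hξ.2 x hx, zero_add] at h
  rw [shape, Pi.neg_apply, map_neg, _root_.neg_apply, hS.metric_tangential hx, h, neg_neg]

theorem metric_shape_comm (hS : S.IsPseudoRiemannian) (hx : x ∈ S.dom) (hξ : S.IsNormalField ξ)
    (hX : S.IsField X) (hY : S.IsField Y) :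
    S.g x (S.shape ξ X x) (Y x) = S.g x (X x) (S.shape ξ Y x) := by
  rw [hS.metric_shape hx hξ X hY, hS.h_symm hx hX hY, ← hS.metric_shape hx hξ Y hX,
    (hS.scalar_g x hx).symm]

theorem covAmbient_covAmbient_push (hS : S.IsPseudoRiemannian) (hx : x ∈ S.dom) (X : E → E)
    (hY : S.IsField Y) (hZ : S.IsField Z) :
    S.covAmbient X (S.covAmbient Y (S.push Z)) x =
      S.push (S.nabla X (S.nabla Y Z)) x + S.h X (S.nabla Y Z) x
        + (S.normalCov X (S.h Y Z) x - S.push (S.shape (S.h Y Z) X) x) := by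
  rw [covAmbient_push Y Z, hS.covAmbient_add hx X (hS.contDiffOn_push (hS.isField_nabla hY hZ))
    (hS.contDiffOn_h hY hZ), covAmbient_push, covAmbient_eq_normalCov_sub_push_shape X (S.h Y Z)]
  rfl

/-- These are the equations of Gauss and Codazzi for the curvature `K` of `∇̃`. -/
theorem connCurvature_push (hS : S.IsPseudoRiemannian) (hx : x ∈ S.dom) (hX : S.IsField X)
    (hY : S.IsField Y) (hZ : S.IsField Z) :
    connCurvature S.θ x (X x) (Y x) (S.push Z x) =
      S.push (S.curvature X Y Z - S.shape (S.h Y Z) X + S.shape (S.h X Z) Y) x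
        + (S.nablaBarH X Y Z x - S.nablaBarH Y X Z x) := by
  rw [← hS.covAmbient_commutator hx hX hY (hS.contDiffOn_push hZ),
    hS.covAmbient_covAmbient_push hx X hY hZ, hS.covAmbient_covAmbient_push hx Y hX hZ,
    covAmbient_push]
  simp only [nablaBarH, curvature, push, Pi.add_apply, Pi.sub_apply, map_add, map_sub,
    hS.h_lieBracket hx X Y Z]
  abel

theorem tangential_eq_of_gaussAt (hS : S.IsPseudoRiemannian) (hx : x ∈ S.dom)
    {Rt : W →L[ℝ] W →L[ℝ] W →L[ℝ] W} (hG : S.GaussAt Rt x) (hX : S.IsField X)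
    (hY : S.IsField Y) (hZ : S.IsField Z) :
    S.tangential (fun y => Rt (S.push X y) (S.push Y y) (S.push Z y)) x =
      (S.curvature X Y Z - S.shape (S.h Y Z) X + S.shape (S.h X Z) Y) x := by
  refine (hS.scalar_g x hx).ext fun t => ?_
  have ht : S.IsField fun _ => t := contDiffOn_const
  have hgauss := hG X Y Z _ hX hY hZ ht
  have hXYZ := hS.metric_shape hx (hS.isNormalField_h hY hZ) X ht
  have hYXZ := hS.metric_shape hx (hS.isNormalField_h hX hZ) Y ht
  rw [(hS.scalar_G x hx).symm] at hXYZ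
  rw [hS.metric_tangential hx]
  simp only [Pi.add_apply, Pi.sub_apply, map_add, map_sub, _root_.add_apply, _root_.sub_apply]
  change _ = S.G x (Rt _ _ _) (S.ι x t) + _ - _ at hgauss
  linarith

theorem apply_push_eq_connCurvature (hS : S.IsPseudoRiemannian) (hx : x ∈ S.dom)
    {Rt : W →L[ℝ] W →L[ℝ] W →L[ℝ] W} (hG : S.GaussAt Rt x) (hC : S.CodazziAt Rt x)
    (hX : S.IsField X) (hY : S.IsField Y) (hZ : S.IsField Z) :
    Rt (S.push X x) (S.push Y x) (S.push Z x) =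
      connCurvature S.θ x (X x) (Y x) (S.push Z x) := by
  have hsplit := congrFun (push_tangential_add_normal (S := S)
    fun y => Rt (S.push X y) (S.push Y y) (S.push Z y)) x
  rw [← hsplit, Pi.add_apply, hC X Y Z hX hY hZ, hS.connCurvature_push hx hX hY hZ, push,
    hS.tangential_eq_of_gaussAt hx hG hX hY hZ, push]

theorem metric_covAmbient_covAmbient (hS : S.IsPseudoRiemannian) (hx : x ∈ S.dom) (X : E → E)
    (hY : S.IsField Y) (hξ : ContDiffOn ℝ ∞ ξ S.dom) (hη : S.IsNormalField η) :
    S.G x (S.covAmbient X (S.covAmbient Y ξ) x) (η x) =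
      S.G x (S.normalCov X (S.normalCov Y ξ) x) (η x)
        - S.g x (S.shape η X x) (S.shape ξ Y x) := by
  have hshape := hS.isField_shape hξ hY
  have hpush : S.G x (S.covAmbient X (S.push (S.shape ξ Y)) x) (η x)
      = S.g x (S.shape η X x) (S.shape ξ Y x) := by
    rw [covAmbient_push, (hS.scalar_G x hx).symm, Pi.add_apply, map_add, push, hη.2 x hx, zero_add,
      hS.metric_shape hx hη X hshape]
  rw [covAmbient_eq_normalCov_sub_push_shape Y ξ, hS.covAmbient_sub hx X
    (hS.contDiffOn_normalCov hξ hY) (hS.contDiffOn_push hshape), map_sub, _root_.sub_apply, hpush,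
    ← hS.metric_normal_apply hx (S.covAmbient X (S.normalCov Y ξ)) hη, ← normalCov]

theorem metric_normalCurvature (hS : S.IsPseudoRiemannian) (hx : x ∈ S.dom) (hX : S.IsField X)
    (hY : S.IsField Y) (hξ : S.IsNormalField ξ) (hη : S.IsNormalField η) :
    S.G x (S.normalCurvature X Y ξ x) (η x) =
      S.G x (connCurvature S.θ x (X x) (Y x) (ξ x)) (η x)
        + S.g x ((S.shape ξ (S.shape η X) - S.shape η (S.shape ξ X)) x) (Y x) := by
  have hbracket : S.G x (S.normalCov (VectorField.lieBracket ℝ X Y) ξ x) (η x)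
      = S.G x (S.covAmbient (VectorField.lieBracket ℝ X Y) ξ x) (η x) :=
    hS.metric_normal_apply hx _ hη
  rw [← hS.covAmbient_commutator hx hX hY hξ.1]
  simp only [normalCurvature, Pi.sub_apply, map_sub, _root_.sub_apply]
  rw [hS.metric_covAmbient_covAmbient hx X hY hξ.1 hη,
    hS.metric_covAmbient_covAmbient hx Y hX hξ.1 hη, normalCov, hbracket,
    hS.metric_shape_comm hx hξ (hS.isField_shape hη.1 hX) hY,
    hS.metric_shape_comm hx hη (hS.isField_shape hξ.1 hX) hY,
    (hS.scalar_g x hx).symm (S.shape η Y x)]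
  ring

theorem ricciAt (hS : S.IsPseudoRiemannian) (hJ : S.HasParallelJ) (hx : x ∈ S.dom)
    (hgen : IsGeneric (S.J x) (S.ι x)) {Rt : W →L[ℝ] W →L[ℝ] W →L[ℝ] W}
    (hR : ∀ X Y Z, Rt X Y (S.J x Z) = S.J x (Rt X Y Z)) (hG : S.GaussAt Rt x)
    (hC : S.CodazziAt Rt x) : S.RicciAt Rt x := by
  intro X Y ξ η hX hY hξ hη
  have htangent : ∀ u, Rt (S.push X x) (S.push Y x) (S.ι x u)
      = connCurvature S.θ x (X x) (Y x) (S.ι x u) := fun u =>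
    hS.apply_push_eq_connCurvature hx hG hC hX hY (Z := fun _ => u) contDiffOn_const
  have hcomplex : ∀ w, connCurvature S.θ x (X x) (Y x) (S.J x w)
      = S.J x (connCurvature S.θ x (X x) (Y x) w) :=
    connCurvature_apply_of_parallel (hS.differentiableAt hS.smooth_θ hx)
      ((hJ.smooth.contDiffAt (hS.isOpen.mem_nhds hx)).of_le ENat.LEInfty.out)
      (Filter.mem_of_superset (hS.isOpen.mem_nhds hx) hJ.parallel) _ _
  have hnormal : Rt (S.push X x) (S.push Y x) (ξ x) = connCurvature S.θ x (X x) (Y x) (ξ x) := by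
    obtain ⟨u, v, huv⟩ := hgen (ξ x)
    rw [huv, map_add, map_add, hR, hcomplex, htangent, htangent]
  rw [hnormal, hS.metric_normalCurvature hx hX hY hξ hη]

end IsPseudoRiemannian

namespace IsLorentzKaehler

theorem isPseudoRiemannian (hS : S.IsLorentzKaehler) : S.IsPseudoRiemannian :=
  { hS with }

theorem hasParallelJ (hS : S.IsLorentzKaehler) : S.HasParallelJ :=
  ⟨hS.smooth_J, hS.parallel_J⟩

theorem isGeneric (hS : S.IsLorentzKaehler) (hE : Module.finrank ℝ E = 2)
    (hW : Module.finrank ℝ W = 4) (hx : x ∈ S.dom) : IsGeneric (S.J x) (S.ι x) :=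
  (hS.lorentz_g x hx).isGeneric hE hW (hS.scalar_g x hx) (hS.scalar_G x hx).symm
    (hS.hermitian x hx).sq (hS.hermitian x hx).hermitian (hS.isometric x hx)

end IsLorentzKaehler

end SurfaceData

/-! ### Isometric immersions in charts -/

section Charts

variable {E : Type*} [NormedAddCommGroup E] [NormedSpace ℝ E]
  {M : Type*} [TopologicalSpace M] [ChartedSpace E M]
  {e : OpenPartialHomeomorph M E} {x : E}

theorem mdifferentiable_of_mem_maximalAtlas (he : e ∈ IsManifold.maximalAtlas 𝓘(ℝ, E) ∞ M) :
    e.MDifferentiable 𝓘(ℝ, E) 𝓘(ℝ, E) :=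
  ⟨(contMDiffOn_of_mem_maximalAtlas he).mdifferentiableOn (by simp),
    (contMDiffOn_symm_of_mem_maximalAtlas he).mdifferentiableOn (by simp)⟩

theorem chartCoframe_chartFrame (he : e ∈ IsManifold.maximalAtlas 𝓘(ℝ, E) ∞ M)
    (hx : x ∈ e.target) (u : E) : chartCoframe e x (chartFrame e x u) = u :=
  congrArg (fun L => L u) ((mdifferentiable_of_mem_maximalAtlas he).comp_symm_deriv hx)

theorem chartFrame_chartCoframe (he : e ∈ IsManifold.maximalAtlas 𝓘(ℝ, E) ∞ M)
    (hx : x ∈ e.target) (v : TangentSpace 𝓘(ℝ, E) (e.symm x)) :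
    chartFrame e x (chartCoframe e x v) = v :=
  (mdifferentiable_of_mem_maximalAtlas he).mfderiv_injective (e.map_target hx)
    (chartCoframe_chartFrame he hx _)

theorem contMDiffOn_chartFrame [IsManifold 𝓘(ℝ, E) ∞ M]
    (he : e ∈ IsManifold.maximalAtlas 𝓘(ℝ, E) ∞ M) (u : E) :
    ContMDiffOn 𝓘(ℝ, E) (𝓘(ℝ, E).prod 𝓘(ℝ, E)) ∞
      (fun x => Bundle.TotalSpace.mk' E (E := fun p : M => TangentSpace 𝓘(ℝ, E) p)
        (e.symm x) (chartFrame e x u)) e.target := by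
  have htangent := (contMDiffOn_symm_of_mem_maximalAtlas he).contMDiffOn_tangentMapWithin
    (m := ∞) (by simp) e.open_target.uniqueMDiffOn
  have hconst : ContMDiff 𝓘(ℝ, E) (𝓘(ℝ, E).prod 𝓘(ℝ, E)) ∞
      (fun x : E => (⟨x, u⟩ : TangentBundle 𝓘(ℝ, E) E)) :=
    contMDiff_vectorSpace_iff_contDiff.2 contDiff_const
  refine (htangent.comp (s := e.target) hconst.contMDiffOn fun x hx => hx).congr fun x hx => ?_
  simp only [Function.comp, tangentMapWithin, chartFrame]
  rw [mfderivWithin_of_isOpen e.open_target hx]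
  rfl

end Charts

namespace SmoothMetric

variable {E : Type*} [NormedAddCommGroup E] [NormedSpace ℝ E]
  {M : Type*} [TopologicalSpace M] [ChartedSpace E M] [IsManifold 𝓘(ℝ, E) ∞ M]
  {e : OpenPartialHomeomorph M E} {x : E}

theorem inChart_mfderiv (g : SmoothMetric E M) (he : e ∈ IsManifold.maximalAtlas 𝓘(ℝ, E) ∞ M)
    {q : M} (hq : q ∈ e.source) (u v : TangentSpace 𝓘(ℝ, E) q) :
    g.inChart e (e q) (mfderiv 𝓘(ℝ, E) 𝓘(ℝ, E) e q u) (mfderiv 𝓘(ℝ, E) 𝓘(ℝ, E) e q v)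
      = g.inner q u v := by
  obtain ⟨y, hy, rfl⟩ : ∃ y ∈ e.target, q = e.symm y :=
    ⟨e q, e.map_source hq, (e.left_inv hq).symm⟩
  rw [e.right_inv hy]
  exact congrArg₂ (fun a b => g.inner (e.symm y) a b) (chartFrame_chartCoframe he hy u)
    (chartFrame_chartCoframe he hy v)

theorem isScalarProduct_inChart (g : SmoothMetric E M)
    (he : e ∈ IsManifold.maximalAtlas 𝓘(ℝ, E) ∞ M) (hx : x ∈ e.target) :
    IsScalarProduct (g.inChart e x) where
  symm _ _ := (g.isScalarProduct (e.symm x)).symm _ _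
  nondegenerate u hu := by
    have hframe : chartFrame e x u = 0 :=
      (g.isScalarProduct (e.symm x)).nondegenerate _ fun v => by
        rw [← chartFrame_chartCoframe he hx v, ← inChart_apply, hu]
    rw [← chartCoframe_chartFrame he hx u, hframe, map_zero]

theorem contDiffOn_inChart [FiniteDimensional ℝ E] (g : SmoothMetric E M)
    (he : e ∈ IsManifold.maximalAtlas 𝓘(ℝ, E) ∞ M) : ContDiffOn ℝ ∞ (g.inChart e) e.target := by
  refine contDiffOn_clm_apply.2 fun u => contDiffOn_clm_apply.2 fun v => ?_
  have h : ContMDiffOn 𝓘(ℝ, E) (𝓘(ℝ, E).prod 𝓘(ℝ)) ∞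
      (fun x => Bundle.TotalSpace.mk' ℝ (E := Bundle.Trivial M ℝ) (e.symm x)
        (g.inner (e.symm x) (chartFrame e x u) (chartFrame e x v))) e.target :=
    ContMDiffOn.clm_bundle_apply₂ (F₁ := E) (F₂ := E)
      (g.contMDiff.comp_contMDiffOn (contMDiffOn_symm_of_mem_maximalAtlas he))
      (contMDiffOn_chartFrame he u) (contMDiffOn_chartFrame he v)
  exact contMDiffOn_iff_contDiffOn.1 fun x hx =>
    (Bundle.contMDiffWithinAt_totalSpace.1 (h x hx)).2

end SmoothMetric

namespace EndField

variable {E : Type*} [NormedAddCommGroup E] [NormedSpace ℝ E]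
  {M : Type*} [TopologicalSpace M] [ChartedSpace E M] [IsManifold 𝓘(ℝ, E) ∞ M]
  {e : OpenPartialHomeomorph M E}

theorem inChart_mfderiv (J : EndField E M) (he : e ∈ IsManifold.maximalAtlas 𝓘(ℝ, E) ∞ M)
    {q : M} (hq : q ∈ e.source) (v : TangentSpace 𝓘(ℝ, E) q) :
    J.inChart e (e q) (mfderiv 𝓘(ℝ, E) 𝓘(ℝ, E) e q v)
      = mfderiv 𝓘(ℝ, E) 𝓘(ℝ, E) e q (J.toFun q v) := by
  obtain ⟨y, hy, rfl⟩ : ∃ y ∈ e.target, q = e.symm y :=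
    ⟨e q, e.map_source hq, (e.left_inv hq).symm⟩
  rw [e.right_inv hy]
  exact congrArg (fun a => chartCoframe e y (J.toFun (e.symm y) a))
    (chartFrame_chartCoframe he hy v)

theorem contDiffOn_inChart [FiniteDimensional ℝ E] (J : EndField E M)
    (he : e ∈ IsManifold.maximalAtlas 𝓘(ℝ, E) ∞ M) : ContDiffOn ℝ ∞ (J.inChart e) e.target := by
  refine contDiffOn_clm_apply.2 fun u => ?_
  have hframe : ContMDiffOn 𝓘(ℝ, E) (𝓘(ℝ, E).prod 𝓘(ℝ, E)) ∞
      (fun x => Bundle.TotalSpace.mk' E (E := fun p : M => TangentSpace 𝓘(ℝ, E) p) (e.symm x)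
        (J.toFun (e.symm x) (chartFrame e x u))) e.target :=
    ContMDiffOn.clm_bundle_apply (F₁ := E) (F₂ := E)
      (J.contMDiff.comp_contMDiffOn (contMDiffOn_symm_of_mem_maximalAtlas he))
      (contMDiffOn_chartFrame he u)
  have htangent := (contMDiffOn_of_mem_maximalAtlas he).contMDiffOn_tangentMapWithin
    (m := ∞) (by simp) e.open_source.uniqueMDiffOn
  have hsnd := (contMDiff_snd_tangentBundle_modelSpace E 𝓘(ℝ, E) (n := ∞)).comp_contMDiffOn
    (htangent.comp (s := e.target) hframe fun x hx => e.map_target hx)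
  refine contMDiffOn_iff_contDiffOn.1 (hsnd.congr fun x hx => ?_)
  simp only [Function.comp, tangentMapWithin]
  rw [mfderivWithin_of_isOpen e.open_source (e.map_target hx)]
  rfl

end EndField

section Immersion

variable {E W M N : Type*} [NormedAddCommGroup E] [NormedAddCommGroup W]
  [TopologicalSpace M] [TopologicalSpace N]
  {φ : M → N} {e : OpenPartialHomeomorph M E} {e' : OpenPartialHomeomorph N W} {x : E}

theorem mapsTo_mapInCharts :
    Set.MapsTo (mapInCharts φ e e') (e.target ∩ e.symm ⁻¹' (φ ⁻¹' e'.source)) e'.target :=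
  fun _ hx => e'.map_source hx.2

theorem isOpen_target_inter_preimage (hφ : Continuous φ) :
    IsOpen (e.target ∩ e.symm ⁻¹' (φ ⁻¹' e'.source)) :=
  e.isOpen_inter_preimage_symm (e'.open_source.preimage hφ)

variable [NormedSpace ℝ E] [NormedSpace ℝ W] [ChartedSpace E M] [ChartedSpace W N]

theorem contDiffOn_mapInCharts (he : e ∈ IsManifold.maximalAtlas 𝓘(ℝ, E) ∞ M)
    (he' : e' ∈ IsManifold.maximalAtlas 𝓘(ℝ, W) ∞ N) (hφ : ContMDiff 𝓘(ℝ, E) 𝓘(ℝ, W) ∞ φ) :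
    ContDiffOn ℝ ∞ (mapInCharts φ e e') (e.target ∩ e.symm ⁻¹' (φ ⁻¹' e'.source)) :=
  contMDiffOn_iff_contDiffOn.1 <| (contMDiffOn_of_mem_maximalAtlas he').comp
    (hφ.comp_contMDiffOn
      ((contMDiffOn_symm_of_mem_maximalAtlas he).mono Set.inter_subset_left)) fun _ hx => hx.2

theorem fderiv_mapInCharts (he : e ∈ IsManifold.maximalAtlas 𝓘(ℝ, E) ∞ M)
    (he' : e' ∈ IsManifold.maximalAtlas 𝓘(ℝ, W) ∞ N)
    (hφ : MDifferentiableAt 𝓘(ℝ, E) 𝓘(ℝ, W) φ (e.symm x)) (hx : x ∈ e.target)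
    (hx' : φ (e.symm x) ∈ e'.source) (u : E) :
    fderiv ℝ (mapInCharts φ e e') x u = mfderiv 𝓘(ℝ, W) 𝓘(ℝ, W) e' (φ (e.symm x))
      (mfderiv 𝓘(ℝ, E) 𝓘(ℝ, W) φ (e.symm x) (chartFrame e x u)) := by
  have hsymm := (mdifferentiable_of_mem_maximalAtlas he).mdifferentiableAt_symm hx
  have hchart : MDifferentiableAt 𝓘(ℝ, W) 𝓘(ℝ, W) e' ((φ ∘ e.symm) x) :=
    (mdifferentiable_of_mem_maximalAtlas he').mdifferentiableAt hx'
  have hcomp := mfderiv_comp x hchart (hφ.comp x hsymm)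
  rw [mfderiv_comp x hφ hsymm] at hcomp
  rw [← mfderiv_eq_fderiv]
  exact congrArg (fun L => L u) hcomp

theorem contDiffAt_mapInCharts (he : e ∈ IsManifold.maximalAtlas 𝓘(ℝ, E) ∞ M)
    (he' : e' ∈ IsManifold.maximalAtlas 𝓘(ℝ, W) ∞ N) (hφ : ContMDiff 𝓘(ℝ, E) 𝓘(ℝ, W) ∞ φ)
    (hx : x ∈ e.target ∩ e.symm ⁻¹' (φ ⁻¹' e'.source)) :
    ContDiffAt ℝ ∞ (mapInCharts φ e e') x :=
  (contDiffOn_mapInCharts he he' hφ).contDiffAt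
    ((isOpen_target_inter_preimage hφ.continuous).mem_nhds hx)

theorem fderiv_comp_mapInCharts {F : Type*} [NormedAddCommGroup F] [NormedSpace ℝ F] {f : W → F}
    (he : e ∈ IsManifold.maximalAtlas 𝓘(ℝ, E) ∞ M)
    (he' : e' ∈ IsManifold.maximalAtlas 𝓘(ℝ, W) ∞ N) (hφ : ContMDiff 𝓘(ℝ, E) 𝓘(ℝ, W) ∞ φ)
    (hx : x ∈ e.target ∩ e.symm ⁻¹' (φ ⁻¹' e'.source))
    (hf : DifferentiableAt ℝ f (mapInCharts φ e e' x)) :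
    fderiv ℝ (fun y => f (mapInCharts φ e e' y)) x =
      (fderiv ℝ f (mapInCharts φ e e' x)).comp (fderiv ℝ (mapInCharts φ e e') x) :=
  fderiv_fun_comp x hf ((contDiffAt_mapInCharts he he' hφ hx).differentiableAt (by simp))

variable [IsManifold 𝓘(ℝ, E) ∞ M] [IsManifold 𝓘(ℝ, W) ∞ N]
  {g : SmoothMetric E M} {gt : SmoothMetric W N} {J : EndField W N}

theorem inChart_fderiv_mapInCharts (he : e ∈ IsManifold.maximalAtlas 𝓘(ℝ, E) ∞ M)
    (he' : e' ∈ IsManifold.maximalAtlas 𝓘(ℝ, W) ∞ N) (hφ : IsIsometricImmersion g gt φ)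
    (hx : x ∈ e.target ∩ e.symm ⁻¹' (φ ⁻¹' e'.source)) (u v : E) :
    gt.inChart e' (mapInCharts φ e e' x) (fderiv ℝ (mapInCharts φ e e') x u)
      (fderiv ℝ (mapInCharts φ e e') x v) = g.inChart e x u v := by
  have hdφ := fderiv_mapInCharts he he' (hφ.smooth.mdifferentiable (by simp) _) hx.1 hx.2
  rw [hdφ, hdφ, mapInCharts, gt.inChart_mfderiv he' hx.2, hφ.isometric,
    SmoothMetric.inChart_apply]

theorem isGeneric_immersionData (he : e ∈ IsManifold.maximalAtlas 𝓘(ℝ, E) ∞ M)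
    (he' : e' ∈ IsManifold.maximalAtlas 𝓘(ℝ, W) ∞ N)
    (hφ : MDifferentiableAt 𝓘(ℝ, E) 𝓘(ℝ, W) φ (e.symm x))
    (hx : x ∈ (immersionData g gt J φ e e').dom)
    (hgen : IsGeneric (J.toFun (φ (e.symm x))) (mfderiv 𝓘(ℝ, E) 𝓘(ℝ, W) φ (e.symm x))) :
    IsGeneric ((immersionData g gt J φ e e').J x) ((immersionData g gt J φ e e').ι x) := by
  intro w
  obtain ⟨a, rfl⟩ := (mdifferentiable_of_mem_maximalAtlas he').mfderiv_surjective hx.2 w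
  obtain ⟨u, v, rfl⟩ := hgen a
  refine ⟨chartCoframe e x u, chartCoframe e x v, ?_⟩
  change _ = fderiv ℝ (mapInCharts φ e e') x _
    + J.inChart e' (e' (φ (e.symm x))) (fderiv ℝ (mapInCharts φ e e') x _)
  rw [fderiv_mapInCharts he he' hφ hx.1 hx.2, fderiv_mapInCharts he he' hφ hx.1 hx.2,
    chartFrame_chartCoframe he hx.1, chartFrame_chartCoframe he hx.1,
    J.inChart_mfderiv he' hx.2, map_add]
  rfl

theorem IsIsometricImmersion.isGeneric_mfderiv (hφ : IsIsometricImmersion g gt φ)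
    (hE : Module.finrank ℝ E = 2) (hW : Module.finrank ℝ W = 4) {p : M}
    (hl : IsLorentzian (g.inner p)) (hK : IsLorentzHermitian (gt.inner (φ p)) (J.toFun (φ p))) :
    IsGeneric (J.toFun (φ p)) (mfderiv 𝓘(ℝ, E) 𝓘(ℝ, W) φ p) :=
  hl.isGeneric hE hW (g.isScalarProduct p) (gt.isScalarProduct (φ p)).symm hK.sq hK.hermitian
    (hφ.isometric p)

variable [FiniteDimensional ℝ W]

theorem hasParallelJ_immersionData (he : e ∈ IsManifold.maximalAtlas 𝓘(ℝ, E) ∞ M)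
    (he' : e' ∈ IsManifold.maximalAtlas 𝓘(ℝ, W) ∞ N) (hφ : ContMDiff 𝓘(ℝ, E) 𝓘(ℝ, W) ∞ φ)
    (hJ : IsParallel gt J) : (immersionData g gt J φ e e').HasParallelJ := by
  have hJe' := J.contDiffOn_inChart he'
  refine ⟨hJe'.comp (contDiffOn_mapInCharts he he' hφ) mapsTo_mapInCharts, fun x hx u a => ?_⟩
  have hy := mapsTo_mapInCharts hx
  have hchain : fderiv ℝ (immersionData g gt J φ e e').J x = _ :=
    fderiv_comp_mapInCharts he he' hφ hx
      ((hJe'.contDiffAt (e'.open_target.mem_nhds hy)).differentiableAt (by simp))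
  rw [hchain]
  exact sub_eq_zero.1 (hJ e' he' _ hy (fderiv ℝ (mapInCharts φ e e') x u) a)

theorem isPseudoRiemannian_immersionData [FiniteDimensional ℝ E]
    (he : e ∈ IsManifold.maximalAtlas 𝓘(ℝ, E) ∞ M)
    (he' : e' ∈ IsManifold.maximalAtlas 𝓘(ℝ, W) ∞ N) (hφ : IsIsometricImmersion g gt φ) :
    (immersionData g gt J φ e e').IsPseudoRiemannian := by
  have hψ := contDiffOn_mapInCharts he he' hφ.smooth
  have hopen := isOpen_target_inter_preimage (e := e) (e' := e') hφ.smooth.continuous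
  have hι := hψ.fderiv_of_isOpen hopen (m := ∞) le_rfl
  have hgt := gt.contDiffOn_inChart he'
  have hsc : ∀ y ∈ e'.target, IsScalarProduct (gt.inChart e' y) := fun y hy =>
    gt.isScalarProduct_inChart he' hy
  have dgt : ∀ y ∈ e'.target, DifferentiableAt ℝ (gt.inChart e') y := fun y hy =>
    (hgt.contDiffAt (e'.open_target.mem_nhds hy)).differentiableAt (by simp)
  exact
    { isOpen := hopen
      smooth_g := (g.contDiffOn_inChart he).mono Set.inter_subset_left
      smooth_ι := hι
      smooth_G := hgt.comp hψ mapsTo_mapInCharts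
      smooth_θ := ((contDiffOn_christoffel e'.open_target hgt hsc).comp hψ
        mapsTo_mapInCharts).clm_comp hι
      scalar_g := fun x hx => g.isScalarProduct_inChart he hx.1
      scalar_G := fun x hx => hsc _ (mapsTo_mapInCharts hx)
      isometric := fun x hx u v => inChart_fderiv_mapInCharts he he' hφ hx u v
      parallel_G := fun x hx u a b => by
        have hy := mapsTo_mapInCharts hx
        have hchain : fderiv ℝ (immersionData g gt J φ e e').G x = _ :=
          fderiv_comp_mapInCharts he he' hφ.smooth hx (dgt _ hy)
        rw [hchain]
        exact fderiv_metric_eq (dgt _ hy)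
          (Filter.mem_of_superset (e'.open_target.mem_nhds hy) hsc) _ a b
      torsion_free := fun x hx u v =>
        have hy := mapsTo_mapInCharts hx
        congrArg₂ (· + ·)
          (fderiv_fderiv_comm
            ((contDiffAt_mapInCharts he he' hφ.smooth hx).of_le ENat.LEInfty.out) u v)
          (christoffel_symm (dgt _ hy) (Filter.mem_of_superset (e'.open_target.mem_nhds hy)
            fun z hz => (hsc z hz).symm) _ _) }

theorem riemann_apply_of_isParallel (hJ : IsParallel gt J)
    (he' : e' ∈ IsManifold.maximalAtlas 𝓘(ℝ, W) ∞ N) {y : W} (hy : y ∈ e'.target) (X Y Z : W) :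
    riemann (gt.inChart e') y X Y (J.inChart e' y Z)
      = J.inChart e' y (riemann (gt.inChart e') y X Y Z) := by
  have hnhds := e'.open_target.mem_nhds hy
  have hΓ := contDiffOn_christoffel e'.open_target (gt.contDiffOn_inChart he')
    fun z hz => gt.isScalarProduct_inChart he' hz
  rw [← connCurvature_christoffel]
  exact connCurvature_apply_of_parallel ((hΓ.contDiffAt hnhds).differentiableAt (by simp))
    (((J.contDiffOn_inChart he').contDiffAt hnhds).of_le ENat.LEInfty.out)
    (Filter.mem_of_superset hnhds fun z hz u a => sub_eq_zero.1 (hJ e' he' z hz u a)) X Y Z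

theorem IsIsometricImmersion.holdsAt_ricciAt [FiniteDimensional ℝ E]
    (hφ : IsIsometricImmersion g gt φ) (hJ : IsParallel gt J) {p : M}
    (hgen : IsGeneric (J.toFun (φ p)) (mfderiv 𝓘(ℝ, E) 𝓘(ℝ, W) φ p))
    (hG : HoldsAt SurfaceData.GaussAt g gt J φ p)
    (hC : HoldsAt SurfaceData.CodazziAt g gt J φ p) :
    HoldsAt SurfaceData.RicciAt g gt J φ p := by
  intro e he hp e' he' hp'
  obtain ⟨x, hx, rfl⟩ : ∃ x ∈ e.target, p = e.symm x :=
    ⟨e p, e.map_source hp, (e.left_inv hp).symm⟩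
  have hG := hG e he hp e' he' hp'
  have hC := hC e he hp e' he' hp'
  rw [e.right_inv hx] at hG hC ⊢
  have hdom : x ∈ (immersionData g gt J φ e e').dom := ⟨hx, hp'⟩
  exact (isPseudoRiemannian_immersionData he he' hφ).ricciAt
    (hasParallelJ_immersionData he he' hφ.smooth hJ) hdom
    (isGeneric_immersionData he he' (hφ.smooth.mdifferentiable (by simp) _) hdom hgen)
    (riemann_apply_of_isParallel hJ he' (e'.map_source hp')) hG hC

end Immersion

end LorentzKaehler

end

open LorentzKaehler in
theorem theorem1_general {E W : Type*} [NormedAddCommGroup E] [NormedSpace ℝ E]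
    [FiniteDimensional ℝ E] [NormedAddCommGroup W] [NormedSpace ℝ W] :
    (∀ [FiniteDimensional ℝ W]
        (M : Type*) [TopologicalSpace M] [ChartedSpace E M] [IsManifold 𝓘(ℝ, E) ∞ M]
        (N : Type*) [TopologicalSpace N] [ChartedSpace W N] [IsManifold 𝓘(ℝ, W) ∞ N]
        (g : SmoothMetric E M) (gt : SmoothMetric W N) (J : EndField W N) (φ : M → N),
        IsParallel gt J → IsIsometricImmersion g gt φ →
        ∀ p : M, IsGeneric (J.toFun (φ p)) (mfderiv 𝓘(ℝ, E) 𝓘(ℝ, W) φ p) →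
          HoldsAt SurfaceData.GaussAt g gt J φ p → HoldsAt SurfaceData.CodazziAt g gt J φ p →
          HoldsAt SurfaceData.RicciAt g gt J φ p) ∧
    (∀ S : SurfaceData E W, S.IsPseudoRiemannian → S.HasParallelJ →
        ∀ x ∈ S.dom, IsGeneric (S.J x) (S.ι x) → ∀ Rt : W →L[ℝ] W →L[ℝ] W →L[ℝ] W,
          (∀ X Y Z, Rt X Y (S.J x Z) = S.J x (Rt X Y Z)) →
          S.GaussAt Rt x → S.CodazziAt Rt x → S.RicciAt Rt x) :=
  ⟨fun _ _ _ _ _ _ _ _ _ _ _ _ hJ hφ _ hgen hG hC => hφ.holdsAt_ricciAt hJ hgen hG hC,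
    fun _ hS hJ _ hx hgen _ hR hG hC => hS.ricciAt hJ hx hgen hR hG hC⟩

/-- The equation of Ricci is a consequence of the equations of Gauss and Codazzi for Lorentz
surfaces in Lorentzian Kaehler surfaces. The first part is about the actual objects of an isometric
immersion. The second part expresses the dependence between the equations: there the ambient
curvature is an arbitrary tensor with the Kaehler symmetries, which is not assumed to be the
curvature of the connection `∇̃` of the Gauss and Weingarten formulas. -/
theorem theorem1 :
    (∀ (M : Type*) [TopologicalSpace M] [ChartedSpace (EuclideanSpace ℝ (Fin 2)) M]
        [IsManifold 𝓘(ℝ, EuclideanSpace ℝ (Fin 2)) ∞ M]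
        (N : Type*) [TopologicalSpace N] [ChartedSpace (EuclideanSpace ℝ (Fin 4)) N]
        [IsManifold 𝓘(ℝ, EuclideanSpace ℝ (Fin 4)) ∞ N]
        (g : LorentzKaehler.SmoothMetric (EuclideanSpace ℝ (Fin 2)) M)
        (gt : LorentzKaehler.SmoothMetric (EuclideanSpace ℝ (Fin 4)) N)
        (J : LorentzKaehler.EndField (EuclideanSpace ℝ (Fin 4)) N) (φ : M → N),
        (∀ p, LorentzKaehler.IsLorentzian (g.inner p)) →
        LorentzKaehler.IsLorentzianKaehler gt J →
        LorentzKaehler.IsIsometricImmersion g gt φ →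
        ∀ p : M,
          LorentzKaehler.HoldsAt LorentzKaehler.SurfaceData.GaussAt g gt J φ p →
          LorentzKaehler.HoldsAt LorentzKaehler.SurfaceData.CodazziAt g gt J φ p →
          LorentzKaehler.HoldsAt LorentzKaehler.SurfaceData.RicciAt g gt J φ p) ∧
    (∀ S : LorentzKaehler.SurfaceData (EuclideanSpace ℝ (Fin 2)) (EuclideanSpace ℝ (Fin 4)),
        S.IsLorentzKaehler →
        ∀ x ∈ S.dom, ∀ Rt : EuclideanSpace ℝ (Fin 4) →L[ℝ] EuclideanSpace ℝ (Fin 4) →L[ℝ]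
            EuclideanSpace ℝ (Fin 4) →L[ℝ] EuclideanSpace ℝ (Fin 4),
          LorentzKaehler.IsKaehlerCurvature (S.G x) (S.J x) Rt →
          S.GaussAt Rt x → S.CodazziAt Rt x → S.RicciAt Rt x) := by
  refine (theorem1_general (E := EuclideanSpace ℝ (Fin 2)) (W := EuclideanSpace ℝ (Fin 4))).imp
    (fun immersion M _ _ _ N _ _ _ g gt J φ hl hK hφ p => ?_) fun bundle S hS x hx Rt hR => ?_
  · exact immersion M N g gt J φ hK.parallel hφ p
      (hφ.isGeneric_mfderiv (by simp) (by simp) (hl p) (hK.hermitian (φ p)))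
  · exact bundle S hS.isPseudoRiemannian hS.hasParallelJ x hx
      (hS.isGeneric (by simp) (by simp) hx) Rt
      (hR.apply_complex (hS.scalar_G x hx) (hS.hermitian x hx))
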